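/- For every $n\in\mathbb N=\{1,2,\dots\}$ let $P_n(x)=\sum_{k=0}^n a_{k:n}x^k$ be a nonzero real polynomial of degree at most $n$ all of whose complex zeros are real and nonpositive. Let $$[\![P_n]\!]_n=\frac1n\sum_{z:\,P_n(z)=0}\delta_z+\frac{n-\deg P_n}{n}\,\delta_{-\infty}$$ (zeros counted with multiplicity) be its empirical distribution of zeros, and suppose that $[\![P_n]\!]_n$ converges weakly, as $n\to\infty$, to a probability measure $\mu$ on $[-\infty,0]$. Put $\underline m:=\mu(\{0\})$ and $\overline m:=1-\mu(\{-\infty\})$, and for $t>0$ $$G_\mu(t)=\int_{(-\infty,0]}\frac{\mu(\mathrm dz)}{t-z},\qquad \Psi(t)=\int_{(-\infty,0]}\log\Big(\frac{t-z}{1-z}\Big)\mu(\mathrm dz).$$ Conventions: $\log 0=-\infty$; over an empty index set a supremum of nonnegative quantities is $0$, any other supremum is $-\infty$, and an infimum is $+\infty$. Then $0\le\underline m\le\overline m\le1$ and there is a function $g:(\underline m,\overline m)\to(-\infty,0]$ such that: (a) $g$ is strictly concave and infinitely differentiable, and for every $\varepsilon>0$, as $n\to\infty$, $$\sup_{(\underline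 m+\varepsilon)n\le k\le(\overline m-\varepsilon)n}\left|\frac1n\log\frac{a_{k:n}}{P_n(1)}-g\Big(\frac kn\Big)\right|\to0,$$ $$\sup_{0\le k\le(\underline m-\varepsilon)n}\frac1n\log\frac{a_{k:n}}{P_n(1)}\to-\infty,\qquad \sup_{(\overline m+\varepsilon)n\le k\le n}\frac1n\log\frac{a_{k:n}}{P_n(1)}\to-\infty.$$ (b) If $\underline m<\overline m$, then $t\mapsto tG_\mu(t)$ maps $(0,\infty)$ to $(\underline m,\overline m)$ and is the inverse of $\alpha\mapsto e^{-g'(\alpha)}$, $\alpha\in(\underline m,\overline m)$. (c) If $\underline m<\overline m$, then $\lim_{\alpha\to\underline m+}g'(\alpha)=+\infty$ and $\lim_{\alpha\to\overline m-}g'(\alpha)=-\infty$. (d) $-g$ is the Legendre transform of $u\mapsto\Psi(e^u)$, that is, $-g(\alpha)=\sup_{u\in\mathbb R}\big(\alpha u-\Psi(e^u)\big)$ for all $\alpha\in(\underline m,\overline m)$. Moreover, if $\underline m<\overline m$, then $\sup_{\alpha\in(\underline m,\overline m)}g(\alpha)=0$. (e) For every $\varepsilon>0$, as $n\to\infty$,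 $$\sup_{(\underline m+\varepsilon)n\le k\le(\overline m-\varepsilon)n}\left|\frac{a_{k+1:n}}{a_{k:n}}-e^{g'(k/n)}\right|\to0,$$ and, with $\underline r_n:=\inf\{k\ge0:a_{k:n}\ne0\}$, $$\inf_{\underline r_n\le k\le(\underline m-\varepsilon)n}\frac{a_{k+1:n}}{a_{k:n}}\to+\infty,\qquad \inf_{(\overline m+\varepsilon)n\le k<\deg P_n}\frac{a_{k:n}}{a_{k+1:n}}\to+\infty.$$ (f) If $\underline m=\overline m$, the last two limits in (a) and the last two limits in (e) still hold. -/

import Mathlib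

open scoped Polynomial Topology ContDiff

namespace ZerosProfile

noncomputable section

/-- `P` is not the zero polynomial and all its complex zeros are real and nonpositive. -/
def NonposRooted (P : ℝ[X]) : Prop :=
  P ≠ 0 ∧ ∀ z : ℂ, Polynomial.aeval z P = 0 → ∃ x : ℝ, x ≤ 0 ∧ z = (x : ℂ)

/-- The empirical distribution of zeros of a real-rooted polynomial `P` of degree at most `n`,
`(1/n) ∑_{z : P(z) = 0} δ_z + ((n - deg P)/n) δ_{-∞}`, zeros being counted with multiplicity,
as a measure on `[-∞, +∞]`. The point at infinity is `⊥ = -∞`. -/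
def empiricalZeros (n : ℕ) (P : ℝ[X]) : MeasureTheory.FiniteMeasure EReal :=
  (n : NNReal)⁻¹ •
    ((P.roots.map fun x : ℝ =>
        (MeasureTheory.diracProba (x : EReal)).toFiniteMeasure).sum +
      (n - P.natDegree) •
        (MeasureTheory.diracProba (⊥ : EReal)).toFiniteMeasure)

/-- The Cauchy transform `G_μ(t) = ∫_ℝ μ(dz) / (t - z)` at a real point `t` of a measure on
`[-∞, +∞]` (atoms at infinity do not contribute). -/
def cauchyTransform (μ : MeasureTheory.Measure EReal) (t : ℝ) : ℝ :=
  ∫ z in Set.Ioo (⊥ : EReal) ⊤, (t - z.toReal)⁻¹ ∂μ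

/-- The normalized logarithmic potential `Ψ(t) = ∫_{(-∞, 0]} log ((t - z) / (1 - z)) μ(dz)`. -/
def logPotential (μ : MeasureTheory.Measure EReal) (t : ℝ) : ℝ :=
  ∫ z in Set.Ioc (⊥ : EReal) 0, Real.log ((t - z.toReal) / (1 - z.toReal)) ∂μ

/-- `(1/n) log (a_k / P(1))` for `P = ∑ a_k x^k`, with the convention `log 0 = -∞`. -/
def logCoeff (n : ℕ) (P : ℝ[X]) (k : ℕ) : EReal :=
  (((n : ℝ)⁻¹ : ℝ) : EReal) * ENNReal.log (ENNReal.ofReal (P.coeff k / P.eval 1))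

/-- The smallest `k` with `a_k ≠ 0`. -/
def lowestIndex (P : ℝ[X]) : ℕ := sInf {k : ℕ | P.coeff k ≠ 0}

end

end ZerosProfile

/-!
Write `P_n = c ∏ (x + r_i)` with `r_i ≥ 0`. For `t > 0` the weights `a_{k:n} t ^ k` are, up to
normalization, the distribution of a sum of independent Bernoulli variables with parameters
`t / (t + r_i)`. Two facts about such a distribution carry the proof.

* Its mean is `∑ t / (t + r_i)`, and the sequence of weights is nondecreasing before the mean and
  nonincreasing after it, up to an error of one index (`coeff_le_of_lt_tiltMean`,
  `mul_coeff_le_of_tiltMean_lt`). This is Darroch's theorem on the mode, and it follows from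
  log-concavity by omitting one factor at a time. It bounds `a_{k+1} / a_k` by `1 / t` from one
  side as soon as `k` is on the known side of the mean at `t`.
* Divided by `n`, the mean at `t` and `log (P_n(t) / P_n(1))` are integrals of continuous functions
  on `[-∞, +∞]` against the empirical distribution of zeros, so weak convergence gives limits
  `m(t) = t G_μ(t)` and `Ψ(t)` (`tendsto_tiltMean_div`, `tendsto_log_eval`).

With the substitution `w = 1 / (1 - z)`, which maps `[-∞, 0]` onto `[0, 1]`, one has
`m(t) = ∫ t w / (1 + (t - 1) w)` and `Ψ(t) = ∫ log (1 + (t - 1) w)`. The function `m` is smooth and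
strictly increasing with range `(m₀, m₁)`, provided `m₀ < m₁`. Let `T` be its inverse and
`g(α) = Ψ(T(α)) - α log T(α)`. Since `t Ψ'(t) = m(t)`, one gets `g' = -log T`
(`hasDerivAt_profile`), and the analytic properties of `g` follow.

If `t₁ < T(α) < t₂`, then for large `n` the means at `t₁` and `t₂` enclose every `k` with `k / n`
close to `α`. Hence `a_{k+1} / a_k` lies between `1 / t₂` and `1 / t₁` (`eventually_ratio_near`),
and `a_k t ^ k` differs from `P_n(t)`, for `t = T(α)`, by a factor of at most
`(n + 1) (t₂ / t₁) ^ n` (`eval_le_of_tiltMean`, `eventually_log_coeff_near`). Compactness makes both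
statements uniform. Outside `[m₀, m₁]` the mean at every fixed `t` is on one side of `k` for large
`n`, and letting `t → 0` or `t → ∞` gives the remaining limits.
-/

namespace ZerosProfile

open Polynomial MeasureTheory Set Filter

/-! ### Coefficients of products of linear factors -/

/-- The monic polynomial `∏ (X + r)` over a multiset of real numbers `r`. -/
noncomputable def shiftProd (s : Multiset ℝ) : ℝ[X] := (s.map fun r => X + C r).prod

/-- Log-concavity of a sequence in the strong form `a j * a (k + 1) ≤ a (j + 1) * a k`, `j ≤ k`,
which for nonnegative sequences also rules out internal zeros. -/
def StrongLogConcave (a : ℕ → ℝ) : Prop :=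
  (∀ k, 0 ≤ a k) ∧ ∀ j k, j ≤ k → a j * a (k + 1) ≤ a (j + 1) * a k

lemma coeff_X_add_C_mul_zero (r : ℝ) (p : ℝ[X]) : ((X + C r) * p).coeff 0 = r * p.coeff 0 := by
  simp [add_mul]

lemma coeff_X_add_C_mul_succ (r : ℝ) (p : ℝ[X]) (k : ℕ) :
    ((X + C r) * p).coeff (k + 1) = p.coeff k + r * p.coeff (k + 1) := by
  simp [add_mul]

lemma StrongLogConcave.X_add_C_mul {r : ℝ} (hr : 0 ≤ r) {p : ℝ[X]}
    (h : StrongLogConcave p.coeff) : StrongLogConcave ((X + C r) * p).coeff := by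
  obtain ⟨h0, h1⟩ := h
  refine ⟨fun k => ?_, fun j k hjk => ?_⟩
  · cases k with
    | zero => rw [coeff_X_add_C_mul_zero]; exact mul_nonneg hr (h0 _)
    | succ k => rw [coeff_X_add_C_mul_succ]; exact add_nonneg (h0 _) (mul_nonneg hr (h0 _))
  · rcases hjk.eq_or_lt with rfl | hlt
    · exact (mul_comm _ _).le
    obtain ⟨k, rfl⟩ : ∃ i, k = i + 1 := ⟨k - 1, by omega⟩
    have hjk : j ≤ k := by omega
    cases j with
    | zero =>
      simp only [coeff_X_add_C_mul_zero, coeff_X_add_C_mul_succ]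
      have e1 := mul_le_mul_of_nonneg_left (h1 0 (k + 1) (by omega)) (mul_nonneg hr hr)
      have e2 := mul_nonneg (h0 0) (h0 k)
      have e3 := mul_nonneg hr (mul_nonneg (h0 1) (h0 k))
      simp only [zero_add] at *
      nlinarith
    | succ j =>
      simp only [coeff_X_add_C_mul_succ]
      have e1 := mul_le_mul_of_nonneg_left (h1 (j + 1) (k + 1) (by omega)) (mul_nonneg hr hr)
      have e2 := h1 j k (by omega)
      have e3 := mul_le_mul_of_nonneg_left
        ((h1 j (k + 1) (by omega)).trans (h1 (j + 1) k hjk)) hr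
      nlinarith

lemma shiftProd_cons (r : ℝ) (s : Multiset ℝ) :
    shiftProd (r ::ₘ s) = (X + C r) * shiftProd s := by
  simp [shiftProd]

lemma strongLogConcave_shiftProd {s : Multiset ℝ} (hs : ∀ r ∈ s, 0 ≤ r) :
    StrongLogConcave (shiftProd s).coeff := by
  induction s using Multiset.induction_on with
  | empty =>
    refine ⟨fun k => ?_, fun j k _ => ?_⟩
    · simp only [shiftProd, Multiset.map_zero, Multiset.prod_zero, coeff_one]
      split_ifs <;> norm_num
    · simp only [shiftProd, Multiset.map_zero, Multiset.prod_zero, coeff_one]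
      simp
  | cons r s ih =>
    rw [shiftProd_cons]
    exact (ih fun x hx => hs x (Multiset.mem_cons_of_mem hx)).X_add_C_mul
      (hs r (Multiset.mem_cons_self r s))

lemma natDegree_shiftProd (s : Multiset ℝ) : (shiftProd s).natDegree = s.card := by
  rw [shiftProd, natDegree_multiset_prod_of_monic]
  · simp
  · intro f hf
    obtain ⟨r, -, rfl⟩ := Multiset.mem_map.1 hf
    exact monic_X_add_C r

/-- Unimodality of `a k * t ^ k`: once it increases, it has not decreased before. -/
lemma StrongLogConcave.le_of_lt {a : ℕ → ℝ} (h : StrongLogConcave a) {t : ℝ} (ht : 0 < t) {k : ℕ}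
    (hk : a (k + 1) < t * a (k + 2)) : a k ≤ t * a (k + 1) := by
  have h1 := h.1 (k + 1)
  have h2 : 0 < a (k + 2) := pos_of_mul_pos_right (h1.trans_lt hk) ht.le
  have h3 := h.2 k (k + 1) (by omega)
  refine le_of_mul_le_mul_right (h3.trans ?_) h2
  nlinarith

/-- The support of a strongly log-concave sequence is an interval. -/
lemma StrongLogConcave.pos_of_le_of_le {a : ℕ → ℝ} (h : StrongLogConcave a) {i j k : ℕ}
    (hi : 0 < a i) (hj : 0 < a j) (hik : i ≤ k) (hkj : k ≤ j) : 0 < a k := by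
  induction k, hik using Nat.le_induction with
  | base => exact hi
  | succ k hik ih =>
    have hk := ih (by omega)
    have h1 := h.2 k (j - 1) (by omega)
    rw [Nat.sub_add_cancel (by omega)] at h1
    exact (h.1 _).lt_of_ne fun h0 => by
      rw [← h0, zero_mul] at h1
      exact absurd h1 (not_le.2 (mul_pos hk hj))

/-- The coefficients of `X * Q' = ∑ (Q - r Q / (X + r))` for `Q = ∏ (X + r)`. -/
lemma sum_coeff_sub_erase (s : Multiset ℝ) (k : ℕ) :
    (s.map fun r => (shiftProd s).coeff k - r * (shiftProd (s.erase r)).coeff k).sum =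
      k * (shiftProd s).coeff k := by
  have h1 : (X * derivative (shiftProd s)).coeff k = k * (shiftProd s).coeff k := by
    cases k with
    | zero => simp
    | succ k => rw [coeff_X_mul, coeff_derivative]; push_cast; ring
  have h2 : X * derivative (shiftProd s) =
      (s.map fun r => shiftProd s - C r * shiftProd (s.erase r)).sum := by
    rw [shiftProd, derivative_prod, ← Multiset.sum_map_mul_left]
    refine congrArg _ (Multiset.map_congr rfl fun r hr => ?_)
    have h3 : shiftProd s = (X + C r) * shiftProd (s.erase r) := by
      rw [← shiftProd_cons, Multiset.cons_erase hr]
    change X * (shiftProd (s.erase r) * derivative (X + C r)) = shiftProd s - _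
    rw [h3, derivative_add, derivative_X, derivative_C]
    ring
  rw [← h1, h2, ← lcoeff_apply k (Multiset.sum _), map_multiset_sum, Multiset.map_map]
  refine congrArg _ (Multiset.map_congr rfl fun r hr => ?_)
  simp

/-- The mean `∑ t / (t + r)` of the probability distribution on `ℕ` with weights proportional to
`a_k t ^ k`, where `∏ (X + r) = ∑ a_k X ^ k`. -/
noncomputable def tiltMean (s : Multiset ℝ) (t : ℝ) : ℝ := (s.map fun r => t / (t + r)).sum

lemma tiltMean_le_card {s : Multiset ℝ} (hs : ∀ r ∈ s, 0 ≤ r) {t : ℝ} (ht : 0 < t) :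
    tiltMean s t ≤ s.card := by
  have h : tiltMean s t ≤ (s.map fun _ => (1 : ℝ)).sum := by
    refine Multiset.sum_map_le_sum_map _ _ fun r hr => ?_
    have := hs r hr
    rw [div_le_one (by positivity)]
    linarith
  simpa using h

lemma count_zero_le_tiltMean {s : Multiset ℝ} (hs : ∀ r ∈ s, 0 ≤ r) {t : ℝ} (ht : 0 < t) :
    (s.count 0 : ℝ) ≤ tiltMean s t := by
  induction s using Multiset.induction_on with
  | empty => simp [tiltMean]
  | cons r s ih =>
    have h1 := ih fun x hx => hs x (Multiset.mem_cons_of_mem hx)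
    have h2 := hs r (Multiset.mem_cons_self r s)
    have h3 : tiltMean (r ::ₘ s) t = t / (t + r) + tiltMean s t := by simp [tiltMean]
    rw [h3]
    by_cases hr : r = 0
    · subst hr
      rw [Multiset.count_cons_self, add_zero, div_self ht.ne']
      push_cast
      linarith
    · rw [Multiset.count_cons_of_ne (Ne.symm hr)]
      have : 0 ≤ t / (t + r) := by positivity
      linarith

lemma coeff_shiftProd_pos {s : Multiset ℝ} (hs : ∀ r ∈ s, 0 ≤ r) {k : ℕ} (h0 : s.count 0 ≤ k)
    (h1 : k ≤ s.card) : 0 < (shiftProd s).coeff k := by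
  induction s using Multiset.induction_on generalizing k with
  | empty =>
    obtain rfl : k = 0 := by simpa using h1
    simp [shiftProd]
  | cons r s ih =>
    have hs' : ∀ x ∈ s, 0 ≤ x := fun x hx => hs x (Multiset.mem_cons_of_mem hx)
    have hnn := (strongLogConcave_shiftProd hs').1
    have hr0 := hs r (Multiset.mem_cons_self r s)
    rw [Multiset.card_cons] at h1
    rw [shiftProd_cons]
    by_cases hr : r = 0
    · subst hr
      rw [Multiset.count_cons_self] at h0
      obtain ⟨k, rfl⟩ : ∃ i, k = i + 1 := ⟨k - 1, by omega⟩
      rw [coeff_X_add_C_mul_succ, zero_mul, add_zero]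
      exact ih hs' (by omega) (by omega)
    · rw [Multiset.count_cons_of_ne (Ne.symm hr)] at h0
      have hr1 : 0 < r := hr0.lt_of_ne (Ne.symm hr)
      cases k with
      | zero =>
        rw [coeff_X_add_C_mul_zero]
        exact mul_pos hr1 (ih hs' h0 (by omega))
      | succ k =>
        rw [coeff_X_add_C_mul_succ]
        rcases h1.eq_or_lt with h | h
        · have := ih hs' (k := k) (by have := Multiset.count_le_card 0 s; omega) (by omega)
          nlinarith [mul_nonneg hr0 (hnn (k + 1))]
        · nlinarith [mul_pos hr1 (ih hs' (k := k + 1) h0 (by omega)), hnn k]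

/-- Below its mean, the sequence `a_k t ^ k` is nondecreasing. If it decreased at `k`, then by
unimodality the analogous sequence for the product with any one factor omitted could not increase
at `k`; summing over the omitted factors compares `k + 1` with the mean. -/
lemma coeff_le_of_lt_tiltMean {s : Multiset ℝ} (hs : ∀ r ∈ s, 0 ≤ r) {t : ℝ} (ht : 0 < t) {k : ℕ}
    (hk : (k + 1 : ℝ) < tiltMean s t) :
    (shiftProd s).coeff k ≤ t * (shiftProd s).coeff (k + 1) := by
  by_contra! hlt
  have hnn := (strongLogConcave_shiftProd hs).1
  have key : tiltMean s t * (shiftProd s).coeff (k + 1) ≤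
      ((k + 1 : ℕ) : ℝ) * (shiftProd s).coeff (k + 1) := by
    rw [← sum_coeff_sub_erase, tiltMean, ← Multiset.sum_map_mul_right]
    refine Multiset.sum_map_le_sum_map _ _ fun r hr => ?_
    have hr0 := hs r hr
    have hE := strongLogConcave_shiftProd (s := s.erase r)
      fun x hx => hs x (Multiset.mem_of_mem_erase hx)
    have h3 : shiftProd s = (X + C r) * shiftProd (s.erase r) := by
      rw [← shiftProd_cons, Multiset.cons_erase hr]
    rw [h3] at hlt ⊢
    set e := (shiftProd (s.erase r)).coeff with he
    have hdec : t * e (k + 1) ≤ e k := by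
      by_contra! hinc
      refine absurd hlt (not_lt.2 ?_)
      cases k with
      | zero =>
        rw [coeff_X_add_C_mul_zero, coeff_X_add_C_mul_succ, ← he]
        nlinarith [hE.1 0]
      | succ k =>
        rw [coeff_X_add_C_mul_succ, coeff_X_add_C_mul_succ, ← he]
        nlinarith [hE.le_of_lt ht hinc]
    rw [coeff_X_add_C_mul_succ, ← he, div_mul_eq_mul_div, div_le_iff₀ (by positivity)]
    nlinarith
  rcases (hnn (k + 1)).eq_or_lt with h0 | h0
  · rw [← h0, mul_zero] at hlt
    have hle := tiltMean_le_card hs ht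
    have : k + 1 < s.card := by exact_mod_cast hk.trans_le hle
    exact h0.not_lt ((strongLogConcave_shiftProd hs).pos_of_le_of_le hlt
      (coeff_shiftProd_pos hs (Multiset.count_le_card 0 s) le_rfl) (Nat.le_succ k) this.le)
  · have := le_of_mul_le_mul_right key h0
    push_cast at this
    linarith

/-- Above its mean, the sequence `a_k t ^ k` is nonincreasing. The argument mirrors
`coeff_le_of_lt_tiltMean`: an increase at `k` would force the product with any one factor omitted
not to decrease from `k - 1` to `k`. -/
lemma mul_coeff_le_of_tiltMean_lt {s : Multiset ℝ} (hs : ∀ r ∈ s, 0 ≤ r) {t : ℝ} (ht : 0 < t)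
    {k : ℕ} (hk : tiltMean s t < k) :
    t * (shiftProd s).coeff (k + 1) ≤ (shiftProd s).coeff k := by
  have hnn := (strongLogConcave_shiftProd hs).1
  by_contra! hlt
  have h0 : 0 < (shiftProd s).coeff k := by
    have h1 : 0 < (shiftProd s).coeff (k + 1) :=
      pos_of_mul_pos_right ((hnn k).trans_lt hlt) ht.le
    have h2 : k + 1 ≤ s.card := by
      rw [← natDegree_shiftProd]
      exact le_natDegree_of_ne_zero h1.ne'
    have h3 : s.count 0 < k := by exact_mod_cast (count_zero_le_tiltMean hs ht).trans_lt hk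
    exact coeff_shiftProd_pos hs h3.le (by omega)
  have key : (k : ℝ) * (shiftProd s).coeff k ≤ tiltMean s t * (shiftProd s).coeff k := by
    rw [← sum_coeff_sub_erase, tiltMean, ← Multiset.sum_map_mul_right]
    refine Multiset.sum_map_le_sum_map _ _ fun r hr => ?_
    have hr0 := hs r hr
    have hE := strongLogConcave_shiftProd (s := s.erase r)
      fun x hx => hs x (Multiset.mem_of_mem_erase hx)
    have h3 : shiftProd s = (X + C r) * shiftProd (s.erase r) := by
      rw [← shiftProd_cons, Multiset.cons_erase hr]
    rw [h3] at hlt ⊢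
    set e := (shiftProd (s.erase r)).coeff with he
    rw [div_mul_eq_mul_div, le_div_iff₀ (by positivity)]
    cases k with
    | zero =>
      rw [coeff_X_add_C_mul_zero, ← he, sub_self, zero_mul]
      exact mul_nonneg ht.le (mul_nonneg hr0 (hE.1 0))
    | succ k =>
      have hinc : e k ≤ t * e (k + 1) := by
        by_contra! hdec
        refine absurd hlt (not_lt.2 ?_)
        have : t * e (k + 2) ≤ e (k + 1) := by
          by_contra! h5
          exact absurd (hE.le_of_lt ht h5) (not_le.2 hdec)
        rw [coeff_X_add_C_mul_succ, coeff_X_add_C_mul_succ, ← he]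
        nlinarith
      rw [coeff_X_add_C_mul_succ, ← he]
      nlinarith
  exact absurd (le_of_mul_le_mul_right key h0) (not_le.2 hk)

lemma eval_shiftProd (s : Multiset ℝ) (t : ℝ) :
    (shiftProd s).eval t = (s.map fun r => t + r).prod := by
  simp [shiftProd, eval_multiset_prod]

lemma eval_shiftProd_pos {s : Multiset ℝ} (hs : ∀ r ∈ s, 0 ≤ r) {t : ℝ} (ht : 0 < t) :
    0 < (shiftProd s).eval t := by
  rw [eval_shiftProd]
  refine Multiset.prod_induction (fun x => 0 < x) _ (fun a b => mul_pos) one_pos fun a ha => ?_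
  obtain ⟨r, hr, rfl⟩ := Multiset.mem_map.1 ha
  linarith [hs r hr]

lemma coeff_mul_pow_le_eval {s : Multiset ℝ} (hs : ∀ r ∈ s, 0 ≤ r) {t : ℝ} (ht : 0 < t) (k : ℕ) :
    (shiftProd s).coeff k * t ^ k ≤ (shiftProd s).eval t := by
  have hnn := (strongLogConcave_shiftProd hs).1
  rw [eval_eq_sum_range' (n := max (s.card + 1) (k + 1))
    (by rw [natDegree_shiftProd]; exact lt_of_lt_of_le (Nat.lt_succ_self _) (le_max_left _ _))]
  exact Finset.single_le_sum (f := fun i => (shiftProd s).coeff i * t ^ i)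
    (fun i _ => mul_nonneg (hnn i) (by positivity)) (Finset.mem_range.2 (by simp))

/-- If the means at `t₁ ≤ t ≤ t₂` enclose `k`, then the `k`-th term of `∑ a_j t ^ j` dominates the
sum up to the factor `(n + 1) (t₂ / t₁) ^ n`: terms with `j ≤ k` are compared through `t₂`,
terms with `j ≥ k` through `t₁`. -/
lemma eval_le_of_tiltMean {s : Multiset ℝ} (hs : ∀ r ∈ s, 0 ≤ r) {n k : ℕ} (hn : s.card ≤ n)
    {t₁ t t₂ : ℝ} (h1 : 0 < t₁) (h1t : t₁ ≤ t) (ht2 : t ≤ t₂)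
    (hk1 : tiltMean s t₁ < k) (hk2 : (k + 1 : ℝ) < tiltMean s t₂) :
    (shiftProd s).eval t ≤ (n + 1) * ((shiftProd s).coeff k * t ^ k * (t₂ / t₁) ^ n) := by
  have ht : 0 < t := h1.trans_le h1t
  have h2 : 0 < t₂ := ht.trans_le ht2
  have hlc := strongLogConcave_shiftProd hs
  set a := (shiftProd s).coeff with ha
  have hkn : k ≤ n := by
    have : (k + 1 : ℝ) < s.card := hk2.trans_le (tiltMean_le_card hs h2)
    have : k + 1 < s.card := by exact_mod_cast this
    omega
  have hlow : ∀ j, j ≤ k → a j * t₂ ^ j ≤ a k * t₂ ^ k := by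
    intro j hj
    induction hj using Nat.decreasingInduction with
    | self => exact le_rfl
    | of_succ i hi ih =>
      refine le_trans ?_ ih
      have hik : (i + 1 : ℝ) ≤ k := by exact_mod_cast hi
      have := coeff_le_of_lt_tiltMean hs h2 (k := i) (by linarith)
      rw [pow_succ']
      calc a i * t₂ ^ i ≤ (t₂ * a (i + 1)) * t₂ ^ i := by gcongr
        _ = _ := by ring
  have hhigh : ∀ j, k ≤ j → a j * t₁ ^ j ≤ a k * t₁ ^ k := by
    intro j hj
    induction j, hj using Nat.le_induction with
    | base => exact le_rfl
    | succ i hi ih =>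
      refine le_trans ?_ ih
      have hik : (k : ℝ) ≤ i := by exact_mod_cast hi
      have := mul_coeff_le_of_tiltMean_lt hs h1 (k := i) (by linarith)
      rw [pow_succ']
      calc a (i + 1) * (t₁ * t₁ ^ i) = (t₁ * a (i + 1)) * t₁ ^ i := by ring
        _ ≤ _ := by gcongr
  have hq : 1 ≤ t₂ / t₁ := (one_le_div h1).2 (h1t.trans ht2)
  rw [eval_eq_sum_range' (n := n + 1) (by rw [natDegree_shiftProd]; omega)]
  have hsum : ∑ i ∈ Finset.range (n + 1), a i * t ^ i ≤
      ∑ i ∈ Finset.range (n + 1), a k * t ^ k * (t₂ / t₁) ^ n := by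
    refine Finset.sum_le_sum fun j hj => ?_
    have hjn : j ≤ n := by have := Finset.mem_range.1 hj; omega
    have hak := hlc.1 k
    rcases le_total j k with hjk | hjk
    · obtain ⟨d, rfl⟩ := Nat.exists_eq_add_of_le hjk
      have e1 : a j ≤ a (j + d) * t₂ ^ d := by
        have := hlow j hjk
        rw [pow_add] at this
        refine le_of_mul_le_mul_right (this.trans_eq ?_) (pow_pos h2 j)
        ring
      calc a j * t ^ j ≤ (a (j + d) * t₂ ^ d) * t ^ j := by gcongr
        _ = a (j + d) * t ^ (j + d) * (t₂ / t) ^ d := by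
          rw [div_pow, pow_add]; field_simp
        _ ≤ a (j + d) * t ^ (j + d) * (t₂ / t₁) ^ d := by gcongr
        _ ≤ a (j + d) * t ^ (j + d) * (t₂ / t₁) ^ n := by
          gcongr
          omega
    · obtain ⟨d, rfl⟩ := Nat.exists_eq_add_of_le hjk
      have e1 : a (k + d) * t₁ ^ d ≤ a k := by
        have := hhigh (k + d) hjk
        rw [pow_add] at this
        refine le_of_mul_le_mul_right (le_trans (le_of_eq ?_) this) (pow_pos h1 k)
        ring
      calc a (k + d) * t ^ (k + d) = (a (k + d) * t₁ ^ d) * t ^ k * (t / t₁) ^ d := by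
            rw [div_pow, pow_add]; field_simp
        _ ≤ a k * t ^ k * (t / t₁) ^ d := by gcongr
        _ ≤ a k * t ^ k * (t₂ / t₁) ^ d := by gcongr
        _ ≤ a k * t ^ k * (t₂ / t₁) ^ n := by
          gcongr
          omega
  simpa using hsum

/-! ### Real-rooted polynomials as products of linear factors -/

lemma NonposRooted.splits {P : ℝ[X]} (h : NonposRooted P) : P.Splits := by
  refine Splits.of_splits_map (algebraMap ℝ ℂ) (IsAlgClosed.splits _) fun z hz => ?_
  obtain ⟨x, -, rfl⟩ := h.2 z (by
    have := (mem_roots'.1 hz).2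
    rwa [IsRoot.def, eval_map_algebraMap] at this)
  exact ⟨x, rfl⟩

lemma NonposRooted.roots_nonpos {P : ℝ[X]} (h : NonposRooted P) {x : ℝ} (hx : x ∈ P.roots) :
    x ≤ 0 := by
  obtain ⟨y, hy, hxy⟩ := h.2 (x : ℂ) (by
    have := (mem_roots'.1 hx).2
    rw [← Complex.coe_algebraMap, aeval_algebraMap_apply, coe_aeval_eq_eval, this.eq_zero]
    simp)
  rw [Complex.ofReal_inj] at hxy
  exact hxy ▸ hy

/-- The absolute values of the zeros of `P`, for `P` with only nonpositive zeros. -/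
noncomputable def negRoots (P : ℝ[X]) : Multiset ℝ := P.roots.map fun x => -x

lemma NonposRooted.negRoots_nonneg {P : ℝ[X]} (h : NonposRooted P) :
    ∀ r ∈ negRoots P, 0 ≤ r := by
  intro r hr
  obtain ⟨x, hx, rfl⟩ := Multiset.mem_map.1 hr
  exact neg_nonneg.2 (h.roots_nonpos hx)

lemma NonposRooted.eq_C_mul_shiftProd {P : ℝ[X]} (h : NonposRooted P) :
    P = C P.leadingCoeff * shiftProd (negRoots P) := by
  conv_lhs => rw [h.splits.eq_prod_roots]
  simp [shiftProd, negRoots, Multiset.map_map, sub_eq_add_neg]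

lemma NonposRooted.card_negRoots {P : ℝ[X]} (h : NonposRooted P) :
    (negRoots P).card = P.natDegree := by
  rw [negRoots, Multiset.card_map, h.splits.natDegree_eq_card_roots]

lemma NonposRooted.coeff_eq {P : ℝ[X]} (h : NonposRooted P) (k : ℕ) :
    P.coeff k = P.leadingCoeff * (shiftProd (negRoots P)).coeff k := by
  conv_lhs => rw [h.eq_C_mul_shiftProd]
  rw [coeff_C_mul]

lemma NonposRooted.leadingCoeff_ne_zero {P : ℝ[X]} (h : NonposRooted P) : P.leadingCoeff ≠ 0 :=
  Polynomial.leadingCoeff_ne_zero.2 h.1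

lemma NonposRooted.coeff_div_coeff {P : ℝ[X]} (h : NonposRooted P) (j k : ℕ) :
    P.coeff j / P.coeff k =
      (shiftProd (negRoots P)).coeff j / (shiftProd (negRoots P)).coeff k := by
  rw [h.coeff_eq, h.coeff_eq, mul_div_mul_left _ _ h.leadingCoeff_ne_zero]

lemma NonposRooted.coeff_div_eval {P : ℝ[X]} (h : NonposRooted P) (k : ℕ) (t : ℝ) :
    P.coeff k / P.eval t =
      (shiftProd (negRoots P)).coeff k / (shiftProd (negRoots P)).eval t := by
  have h1 : P.eval t = P.leadingCoeff * (shiftProd (negRoots P)).eval t := by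
    conv_lhs => rw [h.eq_C_mul_shiftProd]
    rw [eval_mul, eval_C]
  rw [h.coeff_eq, h1, mul_div_mul_left _ _ h.leadingCoeff_ne_zero]

lemma NonposRooted.coeff_pos_of_lowestIndex_le {P : ℝ[X]} (h : NonposRooted P) {k : ℕ}
    (h0 : lowestIndex P ≤ k) (h1 : k ≤ P.natDegree) : 0 < (shiftProd (negRoots P)).coeff k := by
  have hs := h.negRoots_nonneg
  have hlc := strongLogConcave_shiftProd hs
  have hmem : P.coeff (lowestIndex P) ≠ 0 :=
    Nat.sInf_mem (s := {k | P.coeff k ≠ 0}) ⟨_, h.leadingCoeff_ne_zero⟩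
  rw [h.coeff_eq] at hmem
  exact hlc.pos_of_le_of_le ((hlc.1 _).lt_of_ne (Ne.symm (right_ne_zero_of_mul hmem)))
    (coeff_shiftProd_pos hs (Multiset.count_le_card 0 _) le_rfl) h0
    (h1.trans_eq h.card_negRoots.symm)

/-! ### The limiting mean and potential -/

/-- The kernel `x / (1 + (t - 1) x)`. For `x = 1 / (1 - z)` it equals `1 / (t - z)`. -/
noncomputable def tiltKernel (t x : ℝ) : ℝ := x / (1 + (t - 1) * x)

lemma tilt_denom_pos {t x : ℝ} (ht : 0 < t) (h0 : 0 ≤ x) (h1 : x ≤ 1) : 0 < 1 + (t - 1) * x := by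
  rcases h1.eq_or_lt with rfl | h
  · linarith
  · nlinarith [mul_nonneg ht.le h0]

lemma tiltKernel_nonneg {t x : ℝ} (ht : 0 < t) (h0 : 0 ≤ x) (h1 : x ≤ 1) : 0 ≤ tiltKernel t x :=
  div_nonneg h0 (tilt_denom_pos ht h0 h1).le

lemma mul_tiltKernel_le_one {t x : ℝ} (ht : 0 < t) (h0 : 0 ≤ x) (h1 : x ≤ 1) :
    t * tiltKernel t x ≤ 1 := by
  rw [tiltKernel, ← mul_div_assoc, div_le_one (tilt_denom_pos ht h0 h1)]
  nlinarith

lemma tiltKernel_le {c t x : ℝ} (hc : 0 < c) (hct : c ≤ t) (h0 : 0 ≤ x) (h1 : x ≤ 1) :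
    tiltKernel t x ≤ c⁻¹ := by
  have ht := hc.trans_le hct
  have h2 := mul_tiltKernel_le_one ht h0 h1
  have h3 : tiltKernel t x ≤ t⁻¹ := by rw [inv_eq_one_div, le_div_iff₀ ht]; linarith
  exact h3.trans (inv_anti₀ hc hct)

lemma tiltKernel_mul_one_sub_nonneg {t x : ℝ} (ht : 0 < t) (hx : x ∈ Icc 0 1) :
    0 ≤ tiltKernel t x * (1 - t * tiltKernel t x) :=
  mul_nonneg (tiltKernel_nonneg ht hx.1 hx.2) (sub_nonneg.2 (mul_tiltKernel_le_one ht hx.1 hx.2))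

lemma hasDerivAt_tiltKernel_pow {t x : ℝ} (ht : 0 < t) (h0 : 0 ≤ x) (h1 : x ≤ 1) (j : ℕ) :
    HasDerivAt (fun t => tiltKernel t x ^ j) (-j * tiltKernel t x ^ (j + 1)) t := by
  have hd := tilt_denom_pos ht h0 h1
  have e1 : HasDerivAt (fun t : ℝ => 1 + (t - 1) * x) x t := by
    simpa using (((hasDerivAt_id t).sub_const 1).mul_const x).const_add 1
  have e2 : HasDerivAt (fun t => tiltKernel t x) (-(tiltKernel t x ^ 2)) t := by
    refine ((hasDerivAt_const t x).div e1 hd.ne').congr_deriv ?_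
    rw [tiltKernel, div_pow]
    ring
  refine (e2.pow j).congr_deriv ?_
  cases j with
  | zero => simp
  | succ j => simp only [Nat.add_sub_cancel]; ring

lemma hasDerivAt_log_tilt {t x : ℝ} (ht : 0 < t) (h0 : 0 ≤ x) (h1 : x ≤ 1) :
    HasDerivAt (fun t => Real.log (1 + (t - 1) * x)) (tiltKernel t x) t := by
  have e1 : HasDerivAt (fun t : ℝ => 1 + (t - 1) * x) x t := by
    simpa using (((hasDerivAt_id t).sub_const 1).mul_const x).const_add 1
  exact e1.log (tilt_denom_pos ht h0 h1).ne'

lemma abs_log_tilt_le {t x : ℝ} (ht : 0 < t) (h0 : 0 ≤ x) (h1 : x ≤ 1) :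
    |Real.log (1 + (t - 1) * x)| ≤ |Real.log t| := by
  have hd := tilt_denom_pos ht h0 h1
  rcases le_total t 1 with h | h
  · rw [abs_of_nonpos (Real.log_nonpos hd.le (by nlinarith)),
      abs_of_nonpos (Real.log_nonpos ht.le h)]
    exact neg_le_neg (Real.log_le_log ht (by nlinarith))
  · rw [abs_of_nonneg (Real.log_nonneg (by nlinarith)), abs_of_nonneg (Real.log_nonneg h)]
    exact Real.log_le_log hd (by nlinarith)

section Limit

variable {Ω : Type*} [MeasurableSpace Ω] (ν : Measure Ω) (w : Ω → ℝ)

/-- The limiting mean `∫ t w / (1 + (t - 1) w) dν`. -/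
noncomputable def meanFun (t : ℝ) : ℝ := ∫ z, t * tiltKernel t (w z) ∂ν

/-- The limiting potential `∫ log (1 + (t - 1) w) dν`. -/
noncomputable def potFun (t : ℝ) : ℝ := ∫ z, Real.log (1 + (t - 1) * w z) ∂ν

variable {ν w}

lemma integral_indicator_one_eq (hw : Measurable w) (c : ℝ) :
    ∫ z, {z | w z = 1}.indicator (fun _ => c) z ∂ν = ν.real {z | w z = 1} * c := by
  have h : MeasurableSet {z | w z = 1} := hw (measurableSet_singleton 1)
  rw [integral_indicator_const _ h, smul_eq_mul]

variable [IsProbabilityMeasure ν]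

lemma measurable_tiltKernel (hw : Measurable w) (t : ℝ) : Measurable fun z => tiltKernel t (w z) :=
  hw.div ((hw.const_mul _).const_add _)

lemma integrable_tiltKernel_pow (hw : Measurable w) (h01 : ∀ z, w z ∈ Icc 0 1) {t : ℝ}
    (ht : 0 < t) (j : ℕ) : Integrable (fun z => tiltKernel t (w z) ^ j) ν := by
  refine Integrable.of_bound ((measurable_tiltKernel hw t).pow_const j).aestronglyMeasurable
    (t⁻¹ ^ j) (Eventually.of_forall fun z => ?_)
  have h := tiltKernel_nonneg ht (h01 z).1 (h01 z).2
  rw [Real.norm_of_nonneg (pow_nonneg h j)]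
  exact pow_le_pow_left₀ h (tiltKernel_le ht le_rfl (h01 z).1 (h01 z).2) j

lemma integrable_mul_tiltKernel (hw : Measurable w) (h01 : ∀ z, w z ∈ Icc 0 1) {t : ℝ}
    (ht : 0 < t) : Integrable (fun z => t * tiltKernel t (w z)) ν := by
  simpa using (integrable_tiltKernel_pow (ν := ν) hw h01 ht 1).const_mul t

lemma integrable_log_tilt (hw : Measurable w) (h01 : ∀ z, w z ∈ Icc 0 1) {t : ℝ} (ht : 0 < t) :
    Integrable (fun z => Real.log (1 + (t - 1) * w z)) ν :=
  Integrable.of_bound (((hw.const_mul _).const_add _).log).aestronglyMeasurable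
    |Real.log t| (Eventually.of_forall fun z => abs_log_tilt_le ht (h01 z).1 (h01 z).2)

lemma hasDerivAt_integral_tiltKernel_pow (hw : Measurable w) (h01 : ∀ z, w z ∈ Icc 0 1) {t : ℝ}
    (ht : 0 < t) (j : ℕ) :
    HasDerivAt (fun t => ∫ z, tiltKernel t (w z) ^ j ∂ν)
      (-j * ∫ z, tiltKernel t (w z) ^ (j + 1) ∂ν) t := by
  have ht2 : 0 < t / 2 := half_pos ht
  rw [← integral_const_mul]
  refine (hasDerivAt_integral_of_dominated_loc_of_deriv_le (s := Ioi (t / 2))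
    (F' := fun t z => -j * tiltKernel t (w z) ^ (j + 1))
    (bound := fun _ => j * (t / 2)⁻¹ ^ (j + 1)) (Ioi_mem_nhds (half_lt_self ht))
    (Eventually.of_forall fun t => ((measurable_tiltKernel hw t).pow_const j).aestronglyMeasurable)
    (integrable_tiltKernel_pow hw h01 ht j)
    (((measurable_tiltKernel hw t).pow_const (j + 1)).const_mul _).aestronglyMeasurable
    (Eventually.of_forall fun z x hx => ?_) (integrable_const _)
    (Eventually.of_forall fun z x hx => ?_)).2
  · have hx0 : 0 < x := ht2.trans hx
    have h := tiltKernel_nonneg hx0 (h01 z).1 (h01 z).2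
    rw [norm_mul, norm_neg, Real.norm_of_nonneg (pow_nonneg h _), RCLike.norm_natCast]
    gcongr
    exact tiltKernel_le ht2 (le_of_lt hx) (h01 z).1 (h01 z).2
  · exact hasDerivAt_tiltKernel_pow (ht2.trans hx) (h01 z).1 (h01 z).2 j

lemma hasDerivAt_potFun (hw : Measurable w) (h01 : ∀ z, w z ∈ Icc 0 1) {t : ℝ} (ht : 0 < t) :
    HasDerivAt (potFun ν w) (meanFun ν w t / t) t := by
  have ht2 : 0 < t / 2 := half_pos ht
  rw [meanFun, integral_const_mul, mul_div_cancel_left₀ _ ht.ne']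
  refine (hasDerivAt_integral_of_dominated_loc_of_deriv_le (s := Ioi (t / 2))
    (F := fun t z => Real.log (1 + (t - 1) * w z)) (F' := fun t z => tiltKernel t (w z))
    (bound := fun _ => (t / 2)⁻¹) (Ioi_mem_nhds (half_lt_self ht))
    (Eventually.of_forall fun t =>
      (((hw.const_mul _).const_add _).log).aestronglyMeasurable)
    (integrable_log_tilt (ν := ν) hw h01 ht) (measurable_tiltKernel hw t).aestronglyMeasurable
    (Eventually.of_forall fun z x hx => ?_) (integrable_const _)
    (Eventually.of_forall fun z x hx => ?_)).2
  · rw [Real.norm_of_nonneg (tiltKernel_nonneg (ht2.trans hx) (h01 z).1 (h01 z).2)]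
    exact tiltKernel_le ht2 (le_of_lt hx) (h01 z).1 (h01 z).2
  · exact hasDerivAt_log_tilt (ht2.trans hx) (h01 z).1 (h01 z).2

lemma contDiffOn_meanFun (hw : Measurable w) (h01 : ∀ z, w z ∈ Icc 0 1) (n : ℕ) :
    ContDiffOn ℝ n (meanFun ν w) (Ioi 0) := by
  have key : ∀ n j : ℕ, ContDiffOn ℝ n (fun t => ∫ z, tiltKernel t (w z) ^ j ∂ν) (Ioi 0) := by
    intro n
    induction n with
    | zero =>
      intro j
      exact contDiffOn_zero.2 fun t ht =>
        (hasDerivAt_integral_tiltKernel_pow hw h01 ht j).continuousAt.continuousWithinAt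
    | succ n ih =>
      intro j
      push_cast
      refine (contDiffOn_succ_iff_deriv_of_isOpen isOpen_Ioi).2 ⟨fun t ht =>
        (hasDerivAt_integral_tiltKernel_pow hw h01 ht j).differentiableAt.differentiableWithinAt,
        fun h => absurd h (by simp), ?_⟩
      exact (contDiffOn_const.mul (ih (j + 1))).congr fun t ht =>
        (hasDerivAt_integral_tiltKernel_pow hw h01 ht j).deriv
  refine (contDiffOn_id.mul (key n 1)).congr fun t _ => ?_
  simp [meanFun, integral_const_mul]

lemma hasDerivAt_meanFun (hw : Measurable w) (h01 : ∀ z, w z ∈ Icc 0 1) {t : ℝ} (ht : 0 < t) :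
    HasDerivAt (meanFun ν w) (∫ z, tiltKernel t (w z) * (1 - t * tiltKernel t (w z)) ∂ν) t := by
  have h1 := (hasDerivAt_id t).mul (hasDerivAt_integral_tiltKernel_pow (ν := ν) hw h01 ht 1)
  have h2 : meanFun ν w = id * fun t => ∫ z, tiltKernel t (w z) ^ 1 ∂ν := by
    ext t
    simp [meanFun, integral_const_mul]
  rw [h2]
  refine h1.congr_deriv ?_
  have h3 : ∀ z, tiltKernel t (w z) * (1 - t * tiltKernel t (w z)) =
      tiltKernel t (w z) ^ 1 - t * tiltKernel t (w z) ^ 2 := fun z => by ring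
  simp_rw [h3]
  rw [integral_sub (integrable_tiltKernel_pow hw h01 ht 1)
    ((integrable_tiltKernel_pow hw h01 ht 2).const_mul t), integral_const_mul]
  simp
  ring

lemma monotoneOn_meanFun (hw : Measurable w) (h01 : ∀ z, w z ∈ Icc 0 1) :
    MonotoneOn (meanFun ν w) (Ioi 0) := by
  refine monotoneOn_of_deriv_nonneg (convex_Ioi 0)
    (fun t ht => (hasDerivAt_meanFun hw h01 ht).continuousAt.continuousWithinAt)
    (fun t ht => ?_) fun t ht => ?_
  · rw [interior_Ioi] at ht
    exact (hasDerivAt_meanFun hw h01 ht).differentiableAt.differentiableWithinAt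
  · rw [interior_Ioi] at ht
    rw [(hasDerivAt_meanFun hw h01 ht).deriv]
    exact integral_nonneg (fun z => tiltKernel_mul_one_sub_nonneg ht (h01 z))

/-- The length of the range of the mean is `ν {0 < w < 1}`. -/
lemma measure_one_add_measure_between (hw : Measurable w) (h01 : ∀ z, w z ∈ Icc 0 1) :
    ν.real {z | w z = 1} + ν.real {z | w z ∈ Ioo 0 1} = 1 - ν.real {z | w z = 0} := by
  have hm1 : MeasurableSet {z | w z ∈ Ioo 0 1} := hw measurableSet_Ioo
  have hm0 : MeasurableSet {z | w z = 0} := hw (measurableSet_singleton 0)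
  have hdis : Disjoint {z | w z = 1} {z | w z ∈ Ioo 0 1} :=
    Set.disjoint_left.2 fun z h1 h2 => h2.2.ne h1
  rw [← measureReal_union hdis hm1,
    ← probReal_compl_eq_one_sub hm0]
  congr 1
  ext z
  have h := h01 z
  simp only [mem_union, mem_ofPred_eq, mem_Ioo, mem_compl_iff]
  constructor
  · rintro (h | h)
    · rw [h]; norm_num
    · exact h.1.ne'
  · intro h2
    rcases h.2.eq_or_lt with h3 | h3
    · exact Or.inl h3
    · exact Or.inr ⟨h.1.lt_of_ne (Ne.symm h2), h3⟩

lemma deriv_meanFun_pos (hw : Measurable w) (h01 : ∀ z, w z ∈ Icc 0 1)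
    (hlt : ν.real {z | w z = 1} < 1 - ν.real {z | w z = 0}) {t : ℝ} (ht : 0 < t) :
    0 < ∫ z, tiltKernel t (w z) * (1 - t * tiltKernel t (w z)) ∂ν := by
  have hint : Integrable (fun z => tiltKernel t (w z) * (1 - t * tiltKernel t (w z))) ν := by
    have h3 : (fun z => tiltKernel t (w z) * (1 - t * tiltKernel t (w z))) = fun z =>
      tiltKernel t (w z) ^ 1 - t * tiltKernel t (w z) ^ 2 := by ext z; ring
    rw [h3]
    exact (integrable_tiltKernel_pow hw h01 ht 1).sub
      ((integrable_tiltKernel_pow hw h01 ht 2).const_mul t)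
  rw [integral_pos_iff_support_of_nonneg (fun z => tiltKernel_mul_one_sub_nonneg ht (h01 z)) hint]
  have h1 : 0 < ν.real {z | w z ∈ Ioo 0 1} := by
    have := measure_one_add_measure_between (ν := ν) hw h01
    linarith
  refine (ENNReal.toReal_pos_iff.1 h1).1.trans_le (measure_mono fun z hz => ?_)
  have hd := tilt_denom_pos ht (h01 z).1 (h01 z).2
  have h2 : 0 < tiltKernel t (w z) := div_pos hz.1 hd
  have h3 : t * tiltKernel t (w z) < 1 := by
    rw [tiltKernel, ← mul_div_assoc, div_lt_one hd]
    nlinarith [hz.2]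
  exact (mul_pos h2 (sub_pos.2 h3)).ne'

lemma strictMonoOn_meanFun (hw : Measurable w) (h01 : ∀ z, w z ∈ Icc 0 1)
    (hlt : ν.real {z | w z = 1} < 1 - ν.real {z | w z = 0}) :
    StrictMonoOn (meanFun ν w) (Ioi 0) := by
  refine strictMonoOn_of_deriv_pos (convex_Ioi 0)
    (fun t ht => (hasDerivAt_meanFun hw h01 ht).continuousAt.continuousWithinAt) fun t ht => ?_
  rw [interior_Ioi] at ht
  rw [(hasDerivAt_meanFun hw h01 ht).deriv]
  exact deriv_meanFun_pos hw h01 hlt ht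

lemma integral_indicator_ne_zero_eq (hw : Measurable w) (c : ℝ) :
    ∫ z, {z | w z ≠ 0}.indicator (fun _ => c) z ∂ν = (1 - ν.real {z | w z = 0}) * c := by
  have h : MeasurableSet {z | w z = 0} := hw (measurableSet_singleton 0)
  have h2 : {z | w z ≠ 0} = {z | w z = 0}ᶜ := rfl
  rw [h2, integral_indicator_const _ h.compl, smul_eq_mul, probReal_compl_eq_one_sub h]

lemma integrable_indicator_one (hw : Measurable w) (c : ℝ) :
    Integrable ({z | w z = 1}.indicator fun _ => c) ν :=
  (integrable_const c).indicator (hw (measurableSet_singleton 1))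

lemma integrable_indicator_ne_zero (hw : Measurable w) (c : ℝ) :
    Integrable ({z | w z ≠ 0}.indicator fun _ => c) ν :=
  (integrable_const c).indicator (hw (measurableSet_singleton 0)).compl

lemma le_meanFun (hw : Measurable w) (h01 : ∀ z, w z ∈ Icc 0 1) {t : ℝ} (ht : 0 < t) :
    ν.real {z | w z = 1} ≤ meanFun ν w t := by
  rw [← mul_one (ν.real _), ← integral_indicator_one_eq hw 1]
  refine integral_mono (integrable_indicator_one hw 1) (integrable_mul_tiltKernel hw h01 ht)
    fun z => ?_
  by_cases h : w z = 1
  · rw [indicator_of_mem (by exact h), h, tiltKernel]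
    simp [ht.ne']
  · rw [indicator_of_notMem (by exact h)]
    exact mul_nonneg ht.le (tiltKernel_nonneg ht (h01 z).1 (h01 z).2)

lemma meanFun_le (hw : Measurable w) (h01 : ∀ z, w z ∈ Icc 0 1) {t : ℝ} (ht : 0 < t) :
    meanFun ν w t ≤ 1 - ν.real {z | w z = 0} := by
  rw [← mul_one (1 - ν.real _), ← integral_indicator_ne_zero_eq hw 1]
  refine integral_mono (integrable_mul_tiltKernel hw h01 ht) (integrable_indicator_ne_zero hw 1)
    fun z => ?_
  by_cases h : w z = 0
  · rw [indicator_of_notMem (by exact not_not.2 h), h, tiltKernel]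
    simp
  · rw [indicator_of_mem (by exact h)]
    exact mul_tiltKernel_le_one ht (h01 z).1 (h01 z).2

lemma potFun_le_of_le_one (hw : Measurable w) (h01 : ∀ z, w z ∈ Icc 0 1) {t : ℝ} (ht : 0 < t)
    (ht1 : t ≤ 1) : potFun ν w t ≤ ν.real {z | w z = 1} * Real.log t := by
  rw [← integral_indicator_one_eq hw]
  refine integral_mono (integrable_log_tilt hw h01 ht) (integrable_indicator_one hw _) fun z => ?_
  by_cases h : w z = 1
  · rw [indicator_of_mem (by exact h), h]
    simp
  · rw [indicator_of_notMem (by exact h)]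
    have := (h01 z).1
    exact Real.log_nonpos (tilt_denom_pos ht (h01 z).1 (h01 z).2).le (by nlinarith)

lemma potFun_le_of_one_le (hw : Measurable w) (h01 : ∀ z, w z ∈ Icc 0 1) {t : ℝ}
    (ht1 : 1 ≤ t) : potFun ν w t ≤ (1 - ν.real {z | w z = 0}) * Real.log t := by
  have ht : 0 < t := one_pos.trans_le ht1
  rw [← integral_indicator_ne_zero_eq hw]
  refine integral_mono (integrable_log_tilt hw h01 ht) (integrable_indicator_ne_zero hw _)
    fun z => ?_
  by_cases h : w z = 0
  · rw [indicator_of_notMem (by exact not_not.2 h), h]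
    simp
  · rw [indicator_of_mem (by exact h)]
    have := (h01 z).2
    exact Real.log_le_log (tilt_denom_pos ht (h01 z).1 (h01 z).2) (by nlinarith)

lemma tendsto_meanFun_zero (hw : Measurable w) (h01 : ∀ z, w z ∈ Icc 0 1) :
    Tendsto (meanFun ν w) (𝓝[>] 0) (𝓝 (ν.real {z | w z = 1})) := by
  rw [← mul_one (ν.real _), ← integral_indicator_one_eq hw 1]
  have hpos : ∀ᶠ t : ℝ in 𝓝[>] 0, 0 < t := self_mem_nhdsWithin
  refine tendsto_integral_filter_of_dominated_convergence (fun _ => 1)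
    (Eventually.of_forall fun t => ((measurable_tiltKernel hw t).const_mul t).aestronglyMeasurable)
    ?_ (integrable_const _) (Eventually.of_forall fun z => ?_)
  · filter_upwards [hpos] with t ht
    refine Eventually.of_forall fun z => ?_
    rw [Real.norm_of_nonneg (mul_nonneg ht.le (tiltKernel_nonneg ht (h01 z).1 (h01 z).2))]
    exact mul_tiltKernel_le_one ht (h01 z).1 (h01 z).2
  · by_cases h : w z = 1
    · rw [indicator_of_mem (by exact h)]
      refine tendsto_const_nhds.congr' ?_
      filter_upwards [hpos] with t ht
      rw [h, tiltKernel]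
      simp [ht.ne']
    · rw [indicator_of_notMem (by exact h)]
      have h1 : 1 + (0 - 1) * w z ≠ 0 := by
        intro h2; exact h (by linarith)
      have h2 : ContinuousAt (fun t => t * tiltKernel t (w z)) 0 := by
        unfold tiltKernel
        fun_prop (disch := exact h1)
      have h3 := h2.tendsto
      rw [zero_mul] at h3
      exact h3.mono_left nhdsWithin_le_nhds

lemma tendsto_meanFun_atTop (hw : Measurable w) (h01 : ∀ z, w z ∈ Icc 0 1) :
    Tendsto (meanFun ν w) atTop (𝓝 (1 - ν.real {z | w z = 0})) := by
  rw [← mul_one (1 - ν.real _), ← integral_indicator_ne_zero_eq hw 1]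
  have hpos : ∀ᶠ t : ℝ in atTop, 0 < t := eventually_gt_atTop 0
  refine tendsto_integral_filter_of_dominated_convergence (fun _ => 1)
    (Eventually.of_forall fun t => ((measurable_tiltKernel hw t).const_mul t).aestronglyMeasurable)
    ?_ (integrable_const _) (Eventually.of_forall fun z => ?_)
  · filter_upwards [hpos] with t ht
    refine Eventually.of_forall fun z => ?_
    rw [Real.norm_of_nonneg (mul_nonneg ht.le (tiltKernel_nonneg ht (h01 z).1 (h01 z).2))]
    exact mul_tiltKernel_le_one ht (h01 z).1 (h01 z).2
  · by_cases h : w z = 0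
    · rw [indicator_of_notMem (by exact not_not.2 h), h]
      simp [tiltKernel]
    · rw [indicator_of_mem (by exact h)]
      have h1 : Tendsto (fun t : ℝ => w z / ((1 - w z) * t⁻¹ + w z)) atTop
          (𝓝 (w z / ((1 - w z) * 0 + w z))) :=
        tendsto_const_nhds.div ((tendsto_inv_atTop_zero.const_mul _).add tendsto_const_nhds)
          (by simpa using h)
      rw [mul_zero, zero_add, div_self h] at h1
      refine h1.congr' ?_
      filter_upwards [hpos] with t ht
      have hd := (tilt_denom_pos ht (h01 z).1 (h01 z).2).ne'
      have : (1 - w z) * t⁻¹ + w z = (1 + (t - 1) * w z) / t := by field_simp; ring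
      rw [this, tiltKernel, div_div_eq_mul_div]
      ring

end Limit

/-! ### The exponential profile -/

section Profile

variable {Ω : Type*} [MeasurableSpace Ω] (ν : Measure Ω) (w : Ω → ℝ)

/-- The open interval between `ν {w = 1}` and `ν {w ≠ 0}`, which is the range of the limiting mean
if it is nonempty. -/
def meanRange : Set ℝ := Ioo (ν.real {z | w z = 1}) (1 - ν.real {z | w z = 0})

/-- The inverse on `(0, ∞)` of the limiting mean. -/
noncomputable def tiltOf (α : ℝ) : ℝ := Function.invFunOn (meanFun ν w) (Ioi 0) α

/-- The exponential profile `Ψ(T(α)) - α log T(α)`, where `T` inverts the limiting mean and `Ψ` is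
the limiting potential: minus the Legendre transform of `u ↦ Ψ(e ^ u)`. -/
noncomputable def profile (α : ℝ) : ℝ := potFun ν w (tiltOf ν w α) - α * Real.log (tiltOf ν w α)

variable {ν w}

lemma isOpen_meanRange : IsOpen (meanRange ν w) := isOpen_Ioo

variable [IsProbabilityMeasure ν]

lemma meanFun_mem_meanRange (hw : Measurable w) (h01 : ∀ z, w z ∈ Icc 0 1)
    (hlt : ν.real {z | w z = 1} < 1 - ν.real {z | w z = 0}) {t : ℝ} (ht : 0 < t) :
    meanFun ν w t ∈ meanRange ν w := by
  have hm := strictMonoOn_meanFun hw h01 hlt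
  constructor
  · exact (le_meanFun hw h01 (half_pos ht)).trans_lt
      (hm (mem_Ioi.2 (half_pos ht)) (mem_Ioi.2 ht) (half_lt_self ht))
  · have h2 : t < t + 1 := lt_add_one t
    exact (hm (mem_Ioi.2 ht) (mem_Ioi.2 (ht.trans h2)) h2).trans_le
      (meanFun_le hw h01 (ht.trans h2))

lemma exists_meanFun_eq (hw : Measurable w) (h01 : ∀ z, w z ∈ Icc 0 1) {α : ℝ}
    (hα : α ∈ meanRange ν w) : ∃ t ∈ Ioi (0 : ℝ), meanFun ν w t = α := by
  obtain ⟨t₁, h1, ht1⟩ :=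
    (((tendsto_meanFun_zero (ν := ν) hw h01).eventually (gt_mem_nhds hα.1)).and
      self_mem_nhdsWithin).exists
  obtain ⟨t₂, h2, ht2⟩ :=
    (((tendsto_meanFun_atTop (ν := ν) hw h01).eventually (lt_mem_nhds hα.2)).and
      (eventually_ge_atTop t₁)).exists
  have hc : ContinuousOn (meanFun ν w) (Icc t₁ t₂) := fun t ht =>
    (hasDerivAt_meanFun hw h01 (lt_of_lt_of_le ht1 ht.1)).continuousAt.continuousWithinAt
  obtain ⟨t, ht, h⟩ := intermediate_value_Icc ht2 hc ⟨h1.le, h2.le⟩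
  exact ⟨t, lt_of_lt_of_le ht1 ht.1, h⟩

lemma tiltOf_pos (hw : Measurable w) (h01 : ∀ z, w z ∈ Icc 0 1) {α : ℝ}
    (hα : α ∈ meanRange ν w) : 0 < tiltOf ν w α :=
  Function.invFunOn_mem (exists_meanFun_eq hw h01 hα)

lemma meanFun_tiltOf (hw : Measurable w) (h01 : ∀ z, w z ∈ Icc 0 1) {α : ℝ}
    (hα : α ∈ meanRange ν w) : meanFun ν w (tiltOf ν w α) = α :=
  Function.invFunOn_eq (exists_meanFun_eq hw h01 hα)

lemma tiltOf_meanFun (hw : Measurable w) (h01 : ∀ z, w z ∈ Icc 0 1)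
    (hlt : ν.real {z | w z = 1} < 1 - ν.real {z | w z = 0}) {t : ℝ} (ht : 0 < t) :
    tiltOf ν w (meanFun ν w t) = t :=
  have hα := meanFun_mem_meanRange hw h01 hlt ht
  (strictMonoOn_meanFun hw h01 hlt).injOn (tiltOf_pos hw h01 hα) ht (meanFun_tiltOf hw h01 hα)

lemma lt_tiltOf_iff (hw : Measurable w) (h01 : ∀ z, w z ∈ Icc 0 1) {α t : ℝ}
    (hα : α ∈ meanRange ν w) (ht : 0 < t) : t < tiltOf ν w α ↔ meanFun ν w t < α := by
  have h := (strictMonoOn_meanFun hw h01 (hα.1.trans hα.2)).lt_iff_lt ht (tiltOf_pos hw h01 hα)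
  rw [← h, meanFun_tiltOf hw h01 hα]

lemma tiltOf_lt_iff (hw : Measurable w) (h01 : ∀ z, w z ∈ Icc 0 1) {α t : ℝ}
    (hα : α ∈ meanRange ν w) (ht : 0 < t) : tiltOf ν w α < t ↔ α < meanFun ν w t := by
  have h := (strictMonoOn_meanFun hw h01 (hα.1.trans hα.2)).lt_iff_lt (tiltOf_pos hw h01 hα) ht
  rw [← h, meanFun_tiltOf hw h01 hα]

lemma strictMonoOn_tiltOf (hw : Measurable w) (h01 : ∀ z, w z ∈ Icc 0 1) :
    StrictMonoOn (tiltOf ν w) (meanRange ν w) := fun α hα β hβ hαβ => by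
  rw [lt_tiltOf_iff hw h01 hβ (tiltOf_pos hw h01 hα), meanFun_tiltOf hw h01 hα]
  exact hαβ

lemma continuousAt_tiltOf (hw : Measurable w) (h01 : ∀ z, w z ∈ Icc 0 1) {α : ℝ}
    (hα : α ∈ meanRange ν w) : ContinuousAt (tiltOf ν w) α := by
  refine (strictMonoOn_tiltOf hw h01).continuousAt_of_image_mem_nhds
    (isOpen_meanRange.mem_nhds hα) ?_
  refine mem_of_superset (Ioi_mem_nhds (tiltOf_pos hw h01 hα)) fun t ht => ?_
  have hlt := hα.1.trans hα.2
  exact ⟨_, meanFun_mem_meanRange hw h01 hlt ht, tiltOf_meanFun hw h01 hlt ht⟩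

lemma hasDerivAt_tiltOf (hw : Measurable w) (h01 : ∀ z, w z ∈ Icc 0 1) {α : ℝ}
    (hα : α ∈ meanRange ν w) :
    HasDerivAt (tiltOf ν w) (deriv (meanFun ν w) (tiltOf ν w α))⁻¹ α := by
  have hpos := tiltOf_pos hw h01 hα
  have hd := hasDerivAt_meanFun (ν := ν) hw h01 hpos
  refine HasDerivAt.of_local_left_inverse (continuousAt_tiltOf hw h01 hα)
    hd.differentiableAt.hasDerivAt ?_ ?_
  · rw [hd.deriv]
    exact (deriv_meanFun_pos hw h01 (hα.1.trans hα.2) hpos).ne'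
  · filter_upwards [isOpen_meanRange.mem_nhds hα] with β hβ using meanFun_tiltOf hw h01 hβ

lemma contDiffOn_tiltOf (hw : Measurable w) (h01 : ∀ z, w z ∈ Icc 0 1) (n : ℕ) :
    ContDiffOn ℝ n (tiltOf ν w) (meanRange ν w) := by
  induction n with
  | zero =>
    exact contDiffOn_zero.2 fun α hα => (continuousAt_tiltOf hw h01 hα).continuousWithinAt
  | succ n ih =>
    push_cast
    refine (contDiffOn_succ_iff_deriv_of_isOpen isOpen_meanRange).2 ⟨fun α hα =>
      (hasDerivAt_tiltOf hw h01 hα).differentiableAt.differentiableWithinAt,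
      fun h => absurd h (by simp), ?_⟩
    have h1 : ContDiffOn ℝ n (deriv (meanFun ν w)) (Ioi 0) := by
      have h2 := contDiffOn_meanFun (ν := ν) hw h01 (n + 1)
      push_cast at h2
      exact ((contDiffOn_succ_iff_deriv_of_isOpen isOpen_Ioi).1 h2).2.2
    refine ((h1.comp ih fun α hα => tiltOf_pos hw h01 hα).inv fun α hα => ?_).congr fun α hα =>
      (hasDerivAt_tiltOf hw h01 hα).deriv
    have hpos := tiltOf_pos hw h01 hα
    rw [Function.comp_apply, (hasDerivAt_meanFun (ν := ν) hw h01 hpos).deriv]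
    exact (deriv_meanFun_pos hw h01 (hα.1.trans hα.2) hpos).ne'

/-- The envelope formula: the derivative of `T` cancels because `t Ψ'(t)` is the mean. -/
lemma hasDerivAt_profile (hw : Measurable w) (h01 : ∀ z, w z ∈ Icc 0 1) {α : ℝ}
    (hα : α ∈ meanRange ν w) : HasDerivAt (profile ν w) (-Real.log (tiltOf ν w α)) α := by
  have hpos := tiltOf_pos hw h01 hα
  have h1 := hasDerivAt_tiltOf hw h01 hα
  have h2 := (hasDerivAt_potFun (ν := ν) hw h01 hpos).comp α h1
  have h3 := (hasDerivAt_id α).mul (h1.log hpos.ne')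
  refine (h2.sub h3).congr_deriv ?_
  rw [meanFun_tiltOf hw h01 hα]
  simp only [id_eq]
  ring

lemma deriv_profile (hw : Measurable w) (h01 : ∀ z, w z ∈ Icc 0 1) {α : ℝ}
    (hα : α ∈ meanRange ν w) : deriv (profile ν w) α = -Real.log (tiltOf ν w α) :=
  (hasDerivAt_profile hw h01 hα).deriv

lemma exp_neg_deriv_profile (hw : Measurable w) (h01 : ∀ z, w z ∈ Icc 0 1) {α : ℝ}
    (hα : α ∈ meanRange ν w) : Real.exp (-deriv (profile ν w) α) = tiltOf ν w α := by
  rw [deriv_profile hw h01 hα, neg_neg, Real.exp_log (tiltOf_pos hw h01 hα)]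

lemma exp_deriv_profile (hw : Measurable w) (h01 : ∀ z, w z ∈ Icc 0 1) {α : ℝ}
    (hα : α ∈ meanRange ν w) : Real.exp (deriv (profile ν w) α) = (tiltOf ν w α)⁻¹ := by
  rw [deriv_profile hw h01 hα, Real.exp_neg, Real.exp_log (tiltOf_pos hw h01 hα)]

lemma contDiffOn_profile (hw : Measurable w) (h01 : ∀ z, w z ∈ Icc 0 1) :
    ContDiffOn ℝ ∞ (profile ν w) (meanRange ν w) := by
  refine (contDiffOn_infty_iff_deriv_of_isOpen isOpen_meanRange).2 ⟨fun α hα =>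
    (hasDerivAt_profile hw h01 hα).differentiableAt.differentiableWithinAt, ?_⟩
  exact ((contDiffOn_infty.2 (contDiffOn_tiltOf hw h01)).log
    fun α hα => (tiltOf_pos hw h01 hα).ne').neg.congr fun α hα => deriv_profile hw h01 hα

lemma strictConcaveOn_profile (hw : Measurable w) (h01 : ∀ z, w z ∈ Icc 0 1) :
    StrictConcaveOn ℝ (meanRange ν w) (profile ν w) := by
  refine StrictAntiOn.strictConcaveOn_of_deriv (convex_Ioo _ _)
    (contDiffOn_profile hw h01).continuousOn ?_
  rw [interior_Ioo]
  intro α (hα : α ∈ meanRange ν w) β (hβ : β ∈ meanRange ν w) hαβ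
  rw [deriv_profile hw h01 hα, deriv_profile hw h01 hβ]
  exact neg_lt_neg (Real.log_lt_log (tiltOf_pos hw h01 hα) (strictMonoOn_tiltOf hw h01 hα hβ hαβ))

lemma tendsto_deriv_profile_left (hw : Measurable w) (h01 : ∀ z, w z ∈ Icc 0 1)
    (hlt : ν.real {z | w z = 1} < 1 - ν.real {z | w z = 0}) :
    Tendsto (deriv (profile ν w)) (𝓝[>] (ν.real {z | w z = 1})) atTop := by
  refine tendsto_atTop.2 fun B => ?_
  have hm := meanFun_mem_meanRange hw h01 hlt (Real.exp_pos (-B))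
  filter_upwards [Ioo_mem_nhdsGT hm.1] with α hα
  have hα' : α ∈ meanRange ν w := ⟨hα.1, hα.2.trans hm.2⟩
  rw [deriv_profile hw h01 hα', le_neg, Real.log_le_iff_le_exp (tiltOf_pos hw h01 hα')]
  exact ((tiltOf_lt_iff hw h01 hα' (Real.exp_pos _)).2 hα.2).le

lemma tendsto_deriv_profile_right (hw : Measurable w) (h01 : ∀ z, w z ∈ Icc 0 1)
    (hlt : ν.real {z | w z = 1} < 1 - ν.real {z | w z = 0}) :
    Tendsto (deriv (profile ν w)) (𝓝[<] (1 - ν.real {z | w z = 0})) atBot := by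
  refine tendsto_atBot.2 fun B => ?_
  have hm := meanFun_mem_meanRange hw h01 hlt (Real.exp_pos (-B))
  filter_upwards [Ioo_mem_nhdsLT hm.2] with α hα
  have hα' : α ∈ meanRange ν w := ⟨hm.1.trans hα.1, hα.2⟩
  rw [deriv_profile hw h01 hα', neg_le, Real.le_log_iff_exp_le (tiltOf_pos hw h01 hα')]
  exact ((lt_tiltOf_iff hw h01 hα' (Real.exp_pos _)).2 hα.1).le

/-- The concave function `u ↦ α u - Ψ(e ^ u)` has derivative `α - m(e ^ u)`, which vanishes at
`u = log T(α)`. -/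
lemma le_neg_profile (hw : Measurable w) (h01 : ∀ z, w z ∈ Icc 0 1) {α : ℝ}
    (hα : α ∈ meanRange ν w) (u : ℝ) :
    α * u - potFun ν w (Real.exp u) ≤ -profile ν w α := by
  have hpos := tiltOf_pos hw h01 hα
  set f : ℝ → ℝ := fun u => α * u - potFun ν w (Real.exp u) with hf
  have hd : ∀ v, HasDerivAt f (α - meanFun ν w (Real.exp v)) v := fun v => by
    have h1 := (hasDerivAt_potFun (ν := ν) hw h01 (Real.exp_pos v)).comp v (Real.hasDerivAt_exp v)
    rw [div_mul_cancel₀ _ (Real.exp_pos v).ne'] at h1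
    exact (((hasDerivAt_id v).const_mul α).congr_deriv (mul_one α)).sub h1
  have hc : ∀ s : Set ℝ, ContinuousOn f s := fun s v _ =>
    (hd v).continuousAt.continuousWithinAt
  have hfT : f (Real.log (tiltOf ν w α)) = -profile ν w α := by
    rw [hf, profile]
    simp only [Real.exp_log hpos]
    ring
  rw [← hfT]
  change f u ≤ _
  have hmono := monotoneOn_meanFun (ν := ν) hw h01
  rcases le_total u (Real.log (tiltOf ν w α)) with h | h
  · refine monotoneOn_of_deriv_nonneg (convex_Iic _) (hc _)
      (fun v _ => (hd v).differentiableAt.differentiableWithinAt) (fun v hv => ?_)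
      (mem_Iic.2 h) (mem_Iic.2 le_rfl) h
    rw [interior_Iic] at hv
    rw [(hd v).deriv, sub_nonneg]
    conv_rhs => rw [← meanFun_tiltOf hw h01 hα]
    exact hmono (mem_Ioi.2 (Real.exp_pos v)) hpos ((Real.le_log_iff_exp_le hpos).1 (le_of_lt hv))
  · refine antitoneOn_of_deriv_nonpos (convex_Ici _) (hc _)
      (fun v _ => (hd v).differentiableAt.differentiableWithinAt) (fun v hv => ?_)
      (mem_Ici.2 le_rfl) (mem_Ici.2 h) h
    rw [interior_Ici] at hv
    rw [(hd v).deriv, sub_nonpos]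
    conv_lhs => rw [← meanFun_tiltOf hw h01 hα]
    exact hmono hpos (mem_Ioi.2 (Real.exp_pos v)) ((Real.log_le_iff_le_exp hpos).1 (le_of_lt hv))

lemma isLUB_neg_profile (hw : Measurable w) (h01 : ∀ z, w z ∈ Icc 0 1) {α : ℝ}
    (hα : α ∈ meanRange ν w) :
    IsLUB (range fun u => α * u - potFun ν w (Real.exp u)) (-profile ν w α) := by
  refine IsGreatest.isLUB ⟨⟨Real.log (tiltOf ν w α), ?_⟩, ?_⟩
  · simp only [Real.exp_log (tiltOf_pos hw h01 hα), profile]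
    ring
  · rintro _ ⟨u, rfl⟩
    exact le_neg_profile hw h01 hα u

lemma profile_nonpos (hw : Measurable w) (h01 : ∀ z, w z ∈ Icc 0 1) {α : ℝ}
    (hα : α ∈ meanRange ν w) : profile ν w α ≤ 0 := by
  have := le_neg_profile hw h01 hα 0
  simp only [Real.exp_zero, potFun, sub_self, zero_mul, add_zero, Real.log_one, integral_zero,
    mul_zero] at this
  linarith

lemma isLUB_profile (hw : Measurable w) (h01 : ∀ z, w z ∈ Icc 0 1)
    (hlt : ν.real {z | w z = 1} < 1 - ν.real {z | w z = 0}) :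
    IsLUB (profile ν w '' meanRange ν w) 0 := by
  refine IsGreatest.isLUB ⟨⟨_, meanFun_mem_meanRange hw h01 hlt one_pos, ?_⟩, ?_⟩
  · rw [profile, tiltOf_meanFun hw h01 hlt one_pos]
    simp [potFun]
  · rintro _ ⟨α, hα, rfl⟩
    exact profile_nonpos hw h01 hα

end Profile

/-! ### Asymptotics of the coefficients -/

lemma eventually_forall_mem_of_isCompact {K : Set ℝ} (hK : IsCompact K) {p : ℕ → ℝ → Prop}
    (h : ∀ x ∈ K, ∃ U ∈ 𝓝 x, ∀ᶠ n in atTop, ∀ y ∈ U, p n y) :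
    ∀ᶠ n in atTop, ∀ y ∈ K, p n y := by
  choose! U hU hev using h
  obtain ⟨F, hFK, hF⟩ := hK.elim_nhds_subcover U hU
  filter_upwards [(Filter.eventually_all_finset F).2 fun x hx => hev x (hFK x hx)] with n hn y hy
  obtain ⟨x, hx, hyx⟩ := mem_iUnion₂.1 (hF hy)
  exact hn x hx y hyx

lemma tendsto_log_add_one_div : Tendsto (fun n : ℕ => Real.log (n + 1) / n) atTop (𝓝 0) := by
  have h1 : Tendsto (fun n : ℕ => Real.log ((n : ℝ) + 1) / ((n : ℝ) + 1)) atTop (𝓝 0) :=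
    Real.isLittleO_log_id_atTop.tendsto_div_nhds_zero.comp
      (tendsto_atTop_add_const_right _ 1 tendsto_natCast_atTop_atTop)
  have h2 := h1.const_mul 2
  rw [mul_zero] at h2
  refine tendsto_of_tendsto_of_tendsto_of_le_of_le' tendsto_const_nhds h2
    (Eventually.of_forall fun n =>
      div_nonneg (Real.log_nonneg (by linarith [n.cast_nonneg (α := ℝ)])) n.cast_nonneg) ?_
  filter_upwards [eventually_ge_atTop 1] with n hn
  have hn' : (1 : ℝ) ≤ n := by exact_mod_cast hn
  have hl : 0 ≤ Real.log ((n : ℝ) + 1) := Real.log_nonneg (by linarith)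
  rw [← mul_div_assoc, div_le_div_iff₀ (by linarith) (by linarith)]
  nlinarith

section Asymptotics

variable {Ω : Type*} [MeasurableSpace Ω] {ν : Measure Ω} [IsProbabilityMeasure ν] {w : Ω → ℝ}
  {s : ℕ → Multiset ℝ}

/-- If the mean at `t₁` lies below `α` and the mean at `t₂` above it, then for large `n` the means
of the `n`-th distribution at `t₁` and `t₂` enclose all `k` with `k / n` near `α`. -/
lemma exists_nhds_tiltMean (hw : Measurable w) (h01 : ∀ z, w z ∈ Icc 0 1)
    (hM : ∀ t, 0 < t → Tendsto (fun n => tiltMean (s n) t / n) atTop (𝓝 (meanFun ν w t)))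
    {α t₁ t₂ : ℝ} (hα : α ∈ meanRange ν w) (h0 : 0 < t₁) (h1 : t₁ < tiltOf ν w α)
    (h2 : tiltOf ν w α < t₂) :
    ∃ U ∈ 𝓝 α, ∀ᶠ n : ℕ in atTop, ∀ k : ℕ, (k / n : ℝ) ∈ U →
      tiltMean (s n) t₁ < k ∧ (k + 1 : ℝ) < tiltMean (s n) t₂ := by
  have h02 : 0 < t₂ := h0.trans (h1.trans h2)
  obtain ⟨c₁, hc1, hc1α⟩ := exists_between ((lt_tiltOf_iff hw h01 hα h0).1 h1)
  obtain ⟨c₂, hαc2, hc2⟩ := exists_between ((tiltOf_lt_iff hw h01 hα h02).1 h2)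
  obtain ⟨c₃, hc23, hc3⟩ := exists_between hc2
  refine ⟨Ioo c₁ c₂, Ioo_mem_nhds hc1α hαc2, ?_⟩
  filter_upwards [(hM t₁ h0).eventually (gt_mem_nhds hc1), (hM t₂ h02).eventually (lt_mem_nhds hc3),
    tendsto_natCast_atTop_atTop.eventually (eventually_gt_atTop (c₃ - c₂)⁻¹),
    eventually_gt_atTop 0] with n hn1 hn2 hn3 hn0 k hk
  have hn : (0 : ℝ) < n := by exact_mod_cast hn0
  rw [div_lt_iff₀ hn] at hn1
  rw [lt_div_iff₀ hn] at hn2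
  rw [mem_Ioo, lt_div_iff₀ hn, div_lt_iff₀ hn] at hk
  rw [inv_lt_iff_one_lt_mul₀ (sub_pos.2 hc23)] at hn3
  exact ⟨hn1.trans hk.1, by nlinarith [hk.2]⟩

/-- Ratios of consecutive coefficients converge uniformly in the bulk: they are squeezed between
`1 / t₂` and `1 / t₁` for `t₁ < T(α) < t₂` arbitrarily close to each other. -/
lemma eventually_ratio_near (hw : Measurable w) (h01 : ∀ z, w z ∈ Icc 0 1)
    (hs : ∀ᶠ n in atTop, ∀ r ∈ s n, 0 ≤ r)
    (hM : ∀ t, 0 < t → Tendsto (fun n => tiltMean (s n) t / n) atTop (𝓝 (meanFun ν w t)))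
    {K : Set ℝ} (hK : IsCompact K) (hKr : K ⊆ meanRange ν w) {η : ℝ} (hη : 0 < η) :
    ∀ᶠ n : ℕ in atTop, ∀ k : ℕ, (k / n : ℝ) ∈ K →
      |(shiftProd (s n)).coeff (k + 1) / (shiftProd (s n)).coeff k - (tiltOf ν w (k / n))⁻¹|
        ≤ η := by
  have key := eventually_forall_mem_of_isCompact hK (p := fun n x => ∀ k : ℕ, (k / n : ℝ) = x →
      |(shiftProd (s n)).coeff (k + 1) / (shiftProd (s n)).coeff k - (tiltOf ν w (k / n))⁻¹|
        ≤ η) fun α hα => ?_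
  · filter_upwards [key] with n hn k hk using hn _ hk k rfl
  have hα := hKr hα
  set τ := (tiltOf ν w α)⁻¹ with hτ
  have hT := tiltOf_pos hw h01 hα
  have hτ0 : 0 < τ := inv_pos.2 hT
  obtain ⟨c, hc0, hcτ⟩ := exists_between (max_lt hτ0 (sub_lt_self τ (half_pos hη)))
  obtain ⟨hc0, hcη⟩ := max_lt_iff.1 hc0
  have hτη : τ < τ + η / 2 := lt_add_of_pos_right τ (half_pos hη)
  obtain ⟨U, hU, hev⟩ := exists_nhds_tiltMean hw h01 hM hα (t₁ := (τ + η / 2)⁻¹) (t₂ := c⁻¹)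
    (by positivity) (by rw [inv_lt_comm₀ (by positivity) hT]; exact hτη)
    (by rw [lt_inv_comm₀ hT hc0]; exact hcτ)
  have hcont : ContinuousAt (fun x => (tiltOf ν w x)⁻¹) α :=
    (continuousAt_tiltOf hw h01 hα).inv₀ hT.ne'
  have hV := hcont.eventually (Metric.closedBall_mem_nhds _ (half_pos hη))
  refine ⟨_, inter_mem hU hV, ?_⟩
  filter_upwards [hev, hs] with n hn hsn y hy k hk
  subst hk
  obtain ⟨hk1, hk2⟩ := hn k hy.1
  have hy2 : |(tiltOf ν w (k / n))⁻¹ - τ| ≤ η / 2 := hy.2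
  have hpos1 : 0 < (τ + η / 2)⁻¹ := by positivity
  have hpos2 : 0 < c⁻¹ := inv_pos.2 hc0
  have hcard : (k + 1 : ℝ) < (s n).card := hk2.trans_le (tiltMean_le_card hsn hpos2)
  have hcard' : k + 1 < (s n).card := by exact_mod_cast hcard
  have hcount : (s n).count 0 < k := by
    exact_mod_cast (count_zero_le_tiltMean hsn hpos1).trans_lt hk1
  have ha := coeff_shiftProd_pos hsn hcount.le (by omega)
  have e1 := coeff_le_of_lt_tiltMean hsn hpos2 hk2
  have e2 := mul_coeff_le_of_tiltMean_lt hsn hpos1 hk1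
  rw [inv_mul_eq_div, le_div_iff₀ hc0, mul_comm, ← le_div_iff₀ ha] at e1
  rw [inv_mul_eq_div, div_le_iff₀ (by positivity), mul_comm, ← div_le_iff₀ ha] at e2
  rw [abs_le] at hy2 ⊢
  constructor <;> linarith [hy2.1, hy2.2]

/-- Normalized logarithms of coefficients converge uniformly in the bulk. -/
lemma eventually_log_coeff_near (hw : Measurable w) (h01 : ∀ z, w z ∈ Icc 0 1)
    (hs : ∀ᶠ n in atTop, ∀ r ∈ s n, 0 ≤ r) (hcard : ∀ᶠ n in atTop, (s n).card ≤ n)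
    (hM : ∀ t, 0 < t → Tendsto (fun n => tiltMean (s n) t / n) atTop (𝓝 (meanFun ν w t)))
    (hL : ∀ t, 0 < t → Tendsto (fun n : ℕ => (n : ℝ)⁻¹ *
      Real.log ((shiftProd (s n)).eval t / (shiftProd (s n)).eval 1)) atTop (𝓝 (potFun ν w t)))
    {K : Set ℝ} (hK : IsCompact K) (hKr : K ⊆ meanRange ν w) {η : ℝ} (hη : 0 < η) :
    ∀ᶠ n : ℕ in atTop, ∀ k : ℕ, (k / n : ℝ) ∈ K → 0 < (shiftProd (s n)).coeff k ∧
      |(n : ℝ)⁻¹ * Real.log ((shiftProd (s n)).coeff k / (shiftProd (s n)).eval 1)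
        - profile ν w (k / n)| ≤ η := by
  have key := eventually_forall_mem_of_isCompact hK (p := fun n x => ∀ k : ℕ, (k / n : ℝ) = x →
      0 < (shiftProd (s n)).coeff k ∧
      |(n : ℝ)⁻¹ * Real.log ((shiftProd (s n)).coeff k / (shiftProd (s n)).eval 1)
        - profile ν w (k / n)| ≤ η) fun α hα => ?_
  · filter_upwards [key] with n hn k hk using hn _ hk k rfl
  have hα := hKr hα
  have hT := tiltOf_pos hw h01 hα
  set t := tiltOf ν w α with ht
  set δ := η / 10 with hδ
  have hδ0 : 0 < δ := by positivity
  have he : 1 < Real.exp δ := Real.one_lt_exp_iff.2 hδ0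
  have ht1 : t / Real.exp δ < t := div_lt_self hT he
  have ht2 : t < t * Real.exp δ := lt_mul_of_one_lt_right hT he
  have ht10 : 0 < t / Real.exp δ := by positivity
  obtain ⟨U, hU, hev⟩ := exists_nhds_tiltMean hw h01 hM hα ht10 ht1 ht2
  have hV := (hasDerivAt_profile hw h01 hα).continuousAt.eventually
    (Metric.closedBall_mem_nhds _ (by positivity : 0 < 2 * δ))
  have hW := (continuous_mul_const (Real.log t)).continuousAt (x := α) |>.eventually
    (Metric.closedBall_mem_nhds _ (by positivity : 0 < 2 * δ))
  refine ⟨_, inter_mem hU (inter_mem hV hW), ?_⟩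
  filter_upwards [hev, hs, hcard, (hL t hT).eventually
    (Metric.closedBall_mem_nhds _ (by positivity : 0 < 2 * δ)),
    tendsto_log_add_one_div.eventually (ge_mem_nhds (by positivity : 0 < 2 * δ)),
    eventually_gt_atTop 0] with n hn hsn hcn hLn hlog hn0 y hy k hk
  subst hk
  obtain ⟨hk1, hk2⟩ := hn k hy.1
  have hy2 : |profile ν w (k / n) - profile ν w α| ≤ 2 * δ := hy.2.1
  have hy3 : |(k / n : ℝ) * Real.log t - α * Real.log t| ≤ 2 * δ := hy.2.2
  have hLn : |(n : ℝ)⁻¹ * Real.log ((shiftProd (s n)).eval t / (shiftProd (s n)).eval 1)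
    - potFun ν w t| ≤ 2 * δ := hLn
  have hn0' : (0 : ℝ) < n := by exact_mod_cast hn0
  have hQ1 := eval_shiftProd_pos hsn one_pos
  have hQt := eval_shiftProd_pos hsn hT
  have up := coeff_mul_pow_le_eval hsn hT k
  have low := eval_le_of_tiltMean hsn hcn ht10 ht1.le ht2.le hk1 hk2
  have hq : t * Real.exp δ / (t / Real.exp δ) = Real.exp (2 * δ) := by
    rw [two_mul, Real.exp_add]; field_simp
  rw [hq] at low
  have ha : 0 < (shiftProd (s n)).coeff k := by
    refine ((strongLogConcave_shiftProd hsn).1 k).lt_of_ne fun h0 => ?_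
    rw [← h0] at low
    simp only [zero_mul, mul_zero] at low
    exact absurd hQt (not_lt.2 low)
  refine ⟨ha, ?_⟩
  have htk : 0 < t ^ k := pow_pos hT k
  have up' := Real.log_le_log (mul_pos ha htk) up
  have low' := Real.log_le_log hQt low
  rw [Real.log_mul ha.ne' htk.ne', Real.log_pow] at up'
  rw [Real.log_mul (by positivity) (by positivity), Real.log_mul (by positivity) (by positivity),
    Real.log_mul ha.ne' htk.ne', Real.log_pow, Real.log_pow, Real.log_exp] at low'
  rw [Real.log_div ha.ne' hQ1.ne']
  rw [Real.log_div hQt.ne' hQ1.ne'] at hLn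
  set A := Real.log ((shiftProd (s n)).coeff k)
  set B := Real.log ((shiftProd (s n)).eval 1)
  set C := Real.log ((shiftProd (s n)).eval t)
  have hprof : profile ν w α = potFun ν w t - α * Real.log t := rfl
  have up2 : (n : ℝ)⁻¹ * (A - B) ≤ (n : ℝ)⁻¹ * (C - B) - k / n * Real.log t := by
    have : (n : ℝ)⁻¹ * (A - B) ≤ (n : ℝ)⁻¹ * (C - B - k * Real.log t) :=
      mul_le_mul_of_nonneg_left (by linarith) (by positivity)
    refine this.trans_eq ?_
    ring
  have low2 : (n : ℝ)⁻¹ * (C - B) ≤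
      Real.log (n + 1) / n + (n : ℝ)⁻¹ * (A - B) + k / n * Real.log t + 2 * δ := by
    have : (n : ℝ)⁻¹ * (C - B) ≤
        (n : ℝ)⁻¹ * (Real.log (n + 1) + A + k * Real.log t + n * (2 * δ) - B) :=
      mul_le_mul_of_nonneg_left (by linarith) (by positivity)
    refine this.trans_eq ?_
    field_simp
    ring
  rw [abs_le] at *
  constructor <;> linarith [hy2.1, hy2.2, hy3.1, hy3.2, hLn.1, hLn.2]

/-- The limiting mean at any `t` is at least `ν {w = 1}`. -/
lemma eventually_lt_tiltMean_of_le (hw : Measurable w) (h01 : ∀ z, w z ∈ Icc 0 1)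
    (hM : ∀ t, 0 < t → Tendsto (fun n => tiltMean (s n) t / n) atTop (𝓝 (meanFun ν w t)))
    {ε t : ℝ} (hε : 0 < ε) (ht : 0 < t) :
    ∀ᶠ n : ℕ in atTop, ∀ k : ℕ, (k : ℝ) ≤ (ν.real {z | w z = 1} - ε) * n →
      (k + 1 : ℝ) < tiltMean (s n) t := by
  have h1 : ν.real {z | w z = 1} - ε / 2 < meanFun ν w t := by
    linarith [le_meanFun (ν := ν) hw h01 ht]
  filter_upwards [(hM t ht).eventually (lt_mem_nhds h1),
    tendsto_natCast_atTop_atTop.eventually (eventually_gt_atTop (ε / 2)⁻¹),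
    eventually_gt_atTop 0] with n hn1 hn3 hn0 k hk
  have hn : (0 : ℝ) < n := by exact_mod_cast hn0
  rw [lt_div_iff₀ hn] at hn1
  rw [inv_lt_iff_one_lt_mul₀ (half_pos hε)] at hn3
  nlinarith

/-- The limiting mean at any `t` is at most `ν {w ≠ 0}`. -/
lemma eventually_tiltMean_lt_of_le (hw : Measurable w) (h01 : ∀ z, w z ∈ Icc 0 1)
    (hM : ∀ t, 0 < t → Tendsto (fun n => tiltMean (s n) t / n) atTop (𝓝 (meanFun ν w t)))
    {ε t : ℝ} (hε : 0 < ε) (ht : 0 < t) :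
    ∀ᶠ n : ℕ in atTop, ∀ k : ℕ, (1 - ν.real {z | w z = 0} + ε) * n ≤ k →
      tiltMean (s n) t < k := by
  have h1 : meanFun ν w t < 1 - ν.real {z | w z = 0} + ε := by
    linarith [meanFun_le (ν := ν) hw h01 ht]
  filter_upwards [(hM t ht).eventually (gt_mem_nhds h1), eventually_gt_atTop 0] with n hn1 hn0 k hk
  have hn : (0 : ℝ) < n := by exact_mod_cast hn0
  rw [div_lt_iff₀ hn] at hn1
  exact hn1.trans_le hk

/-- The bound `a_k ≤ t ^ (-k) Q(t)` for `Q = ∏ (X + r)`, in normalized logarithms. -/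
lemma log_coeff_le {s : Multiset ℝ} (hs : ∀ r ∈ s, 0 ≤ r) {t : ℝ} (ht : 0 < t) {n k : ℕ}
    (ha : 0 < (shiftProd s).coeff k) :
    (n : ℝ)⁻¹ * Real.log ((shiftProd s).coeff k / (shiftProd s).eval 1) ≤
      (n : ℝ)⁻¹ * Real.log ((shiftProd s).eval t / (shiftProd s).eval 1)
        - (n : ℝ)⁻¹ * (k * Real.log t) := by
  have hQ1 := eval_shiftProd_pos hs one_pos
  have up := Real.log_le_log (by positivity) (coeff_mul_pow_le_eval hs ht k)
  rw [Real.log_mul ha.ne' (by positivity), Real.log_pow] at up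
  rw [Real.log_div ha.ne' hQ1.ne', Real.log_div (eval_shiftProd_pos hs ht).ne' hQ1.ne', ← mul_sub]
  exact mul_le_mul_of_nonneg_left (by linarith) (by positivity)

/-- Coefficients of low index decay superexponentially: let `t → 0` in the bound
`a_k ≤ t ^ (-k) Q(t)`. -/
lemma eventually_log_coeff_le_of_le (hw : Measurable w) (h01 : ∀ z, w z ∈ Icc 0 1)
    (hs : ∀ᶠ n in atTop, ∀ r ∈ s n, 0 ≤ r)
    (hL : ∀ t, 0 < t → Tendsto (fun n : ℕ => (n : ℝ)⁻¹ *
      Real.log ((shiftProd (s n)).eval t / (shiftProd (s n)).eval 1)) atTop (𝓝 (potFun ν w t)))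
    {ε B : ℝ} (hε : 0 < ε) (hB : 0 < B) :
    ∀ᶠ n : ℕ in atTop, ∀ k : ℕ, (k : ℝ) ≤ (ν.real {z | w z = 1} - ε) * n →
      0 < (shiftProd (s n)).coeff k →
      (n : ℝ)⁻¹ * Real.log ((shiftProd (s n)).coeff k / (shiftProd (s n)).eval 1) ≤ -B := by
  -- With this choice, `ε * log t = -(B + 1)`.
  set t := Real.exp (-((B + 1) / ε)) with ht
  have ht0 : 0 < t := Real.exp_pos _
  have hlog : Real.log t = -((B + 1) / ε) := Real.log_exp _
  have hneg : -((B + 1) / ε) ≤ 0 := by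
    rw [neg_nonpos]; positivity
  have hP := potFun_le_of_le_one (ν := ν) hw h01 ht0 (Real.exp_le_one_iff.2 hneg)
  have hεlog : ε * Real.log t = -(B + 1) := by rw [hlog]; field_simp
  filter_upwards [hs, (hL t ht0).eventually (gt_mem_nhds (lt_add_one _)),
    eventually_gt_atTop 0] with n hsn hLn hn0 k hk ha
  have hn : (0 : ℝ) < n := by exact_mod_cast hn0
  refine (log_coeff_le hsn ht0 ha).trans ?_
  have h1 : (n : ℝ)⁻¹ * (k * -Real.log t) ≤ (ν.real {z | w z = 1} - ε) * -Real.log t := by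
    rw [← mul_assoc]
    refine mul_le_mul_of_nonneg_right ?_ (by rw [hlog]; linarith)
    rw [inv_mul_eq_div, div_le_iff₀ hn]
    exact hk
  linarith

/-- Coefficients of high index decay superexponentially: let `t → ∞` in the bound
`a_k ≤ t ^ (-k) Q(t)`. -/
lemma eventually_log_coeff_le_of_ge (hw : Measurable w) (h01 : ∀ z, w z ∈ Icc 0 1)
    (hs : ∀ᶠ n in atTop, ∀ r ∈ s n, 0 ≤ r)
    (hL : ∀ t, 0 < t → Tendsto (fun n : ℕ => (n : ℝ)⁻¹ *
      Real.log ((shiftProd (s n)).eval t / (shiftProd (s n)).eval 1)) atTop (𝓝 (potFun ν w t)))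
    {ε B : ℝ} (hε : 0 < ε) (hB : 0 < B) :
    ∀ᶠ n : ℕ in atTop, ∀ k : ℕ, (1 - ν.real {z | w z = 0} + ε) * n ≤ k →
      0 < (shiftProd (s n)).coeff k →
      (n : ℝ)⁻¹ * Real.log ((shiftProd (s n)).coeff k / (shiftProd (s n)).eval 1) ≤ -B := by
  -- With this choice, `ε * log t = B + 1`.
  set t := Real.exp ((B + 1) / ε) with ht
  have ht0 : 0 < t := Real.exp_pos _
  have hlog : Real.log t = (B + 1) / ε := Real.log_exp _
  have hnn : 0 ≤ (B + 1) / ε := by positivity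
  have hP := potFun_le_of_one_le (ν := ν) hw h01 (Real.one_le_exp hnn)
  have hεlog : ε * Real.log t = B + 1 := by rw [hlog]; field_simp
  filter_upwards [hs, (hL t ht0).eventually (gt_mem_nhds (lt_add_one _)),
    eventually_gt_atTop 0] with n hsn hLn hn0 k hk ha
  have hn : (0 : ℝ) < n := by exact_mod_cast hn0
  refine (log_coeff_le hsn ht0 ha).trans ?_
  have h1 : (1 - ν.real {z | w z = 0} + ε) * Real.log t ≤ (n : ℝ)⁻¹ * (k * Real.log t) := by
    rw [← mul_assoc]
    refine mul_le_mul_of_nonneg_right ?_ (by rw [hlog]; exact hnn)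
    rw [inv_mul_eq_div, le_div_iff₀ hn]
    exact hk
  linarith

end Asymptotics

/-! ### Weak convergence of empirical zero distributions -/

/-- The function `z ↦ 1 / (1 - z)` on `[-∞, 0]`, with value `0` at `-∞`, extended by `1` to
positive `z`. It is continuous, and all test functions to be integrated factor through it. -/
noncomputable def weight (z : EReal) : ℝ := ((1 + (-z).toENNReal)⁻¹).toReal

lemma continuous_weight : Continuous weight := by
  refine continuous_iff_continuousAt.2 fun z => ?_
  refine (ENNReal.continuousAt_toReal (by simp)).comp ?_
  exact (continuous_inv.comp
    (continuous_const.add (EReal.continuous_toENNReal.comp continuous_neg))).continuousAt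

lemma weight_mem (z : EReal) : weight z ∈ Icc 0 1 := by
  refine ⟨ENNReal.toReal_nonneg, ?_⟩
  refine ENNReal.toReal_le_of_le_ofReal zero_le_one ?_
  rw [ENNReal.ofReal_one, ENNReal.inv_le_one]
  exact le_self_add

lemma weight_bot : weight ⊥ = 0 := by simp [weight]

lemma weight_coe {x : ℝ} (hx : x ≤ 0) : weight (x : EReal) = (1 - x)⁻¹ := by
  rw [weight, ← EReal.coe_neg, EReal.toENNReal_of_ne_top (EReal.coe_ne_top _), EReal.toReal_coe,
    ENNReal.toReal_inv, ENNReal.toReal_add (by simp) (by simp), ENNReal.toReal_ofReal (by linarith)]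
  simp [sub_eq_add_neg]

lemma weight_eq_zero_iff {z : EReal} : weight z = 0 ↔ z = ⊥ := by
  rw [weight, ENNReal.toReal_eq_zero_iff]
  simp [EReal.toENNReal_eq_top_iff, EReal.neg_eq_top_iff]

lemma weight_eq_one_iff {z : EReal} (hz : z ≤ 0) : weight z = 1 ↔ z = 0 := by
  induction z with
  | bot => simp [weight_bot]
  | top => simp at hz
  | coe x =>
    have hx : x ≤ 0 := by exact_mod_cast hz
    rw [weight_coe hx, inv_eq_one]
    constructor
    · intro h
      have : x = 0 := by linarith
      simp [this]
    · intro h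
      have : x = 0 := by exact_mod_cast h
      simp [this]

lemma mul_tiltKernel_weight_coe {t x : ℝ} (ht : 0 < t) (hx : x ≤ 0) :
    t * tiltKernel t (weight x) = t * (t - x)⁻¹ := by
  have h1 : 1 - x ≠ 0 := by linarith
  have h2 : t - x ≠ 0 := by linarith
  rw [weight_coe hx, tiltKernel]
  have h3 : 1 + (t - 1) * (1 - x)⁻¹ = (t - x) / (1 - x) := by field_simp; ring
  rw [h3]
  field_simp

lemma log_tilt_weight_coe {t x : ℝ} (hx : x ≤ 0) :
    Real.log (1 + (t - 1) * weight x) = Real.log ((t - x) / (1 - x)) := by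
  have h1 : 1 - x ≠ 0 := by linarith
  rw [weight_coe hx]
  congr 1
  field_simp
  ring

lemma mul_cauchyTransform_eq {μ : Measure EReal} (hμ : ∀ᵐ z ∂μ, z ≤ 0) {t : ℝ} (ht : 0 < t) :
    t * cauchyTransform μ t = meanFun μ weight t := by
  rw [cauchyTransform, meanFun, ← integral_const_mul, ← integral_indicator measurableSet_Ioo]
  refine integral_congr_ae ?_
  filter_upwards [hμ] with z hz
  induction z with
  | bot => simp [weight_bot, tiltKernel]
  | top => simp at hz
  | coe x =>
    have hx : x ≤ 0 := by exact_mod_cast hz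
    rw [indicator_of_mem (by simp), EReal.toReal_coe, mul_tiltKernel_weight_coe ht hx]

lemma logPotential_eq {μ : Measure EReal} (hμ : ∀ᵐ z ∂μ, z ≤ 0) (t : ℝ) :
    logPotential μ t = potFun μ weight t := by
  rw [logPotential, potFun, ← integral_indicator measurableSet_Ioc]
  refine integral_congr_ae ?_
  filter_upwards [hμ] with z hz
  induction z with
  | bot => simp [weight_bot]
  | top => simp at hz
  | coe x =>
    have hx : x ≤ 0 := by exact_mod_cast hz
    rw [indicator_of_mem (mem_Ioc.2 ⟨EReal.bot_lt_coe x, hz⟩), EReal.toReal_coe,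
      log_tilt_weight_coe hx]

lemma measure_weight_eq_one {μ : Measure EReal} (hμ : ∀ᵐ z ∂μ, z ≤ 0) :
    μ.real {z | weight z = 1} = μ.real {0} := by
  refine measureReal_congr ?_
  filter_upwards [hμ] with z hz
  exact propext (weight_eq_one_iff hz)

lemma setOf_weight_eq_zero : {z | weight z = 0} = {⊥} := by
  ext z
  exact weight_eq_zero_iff

lemma integral_multiset_sum_dirac (f : BoundedContinuousFunction EReal ℝ) (s : Multiset ℝ) :
    ∫ z, f z ∂((s.map fun x : ℝ =>
      (diracProba (x : EReal)).toFiniteMeasure).sum : FiniteMeasure EReal).toMeasure =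
      (s.map fun x : ℝ => f x).sum := by
  induction s using Multiset.induction_on with
  | empty => simp
  | cons x s ih =>
    rw [Multiset.map_cons, Multiset.sum_cons, FiniteMeasure.toMeasure_add,
      integral_add_measure (f.integrable _) (f.integrable _), ih, Multiset.map_cons,
      Multiset.sum_cons]
    congr 1
    exact integral_dirac _ _

lemma integral_empiricalZeros (f : BoundedContinuousFunction EReal ℝ) (n : ℕ) (P : ℝ[X]) :
    ∫ z, f z ∂(empiricalZeros n P).toMeasure =
      (n : ℝ)⁻¹ * ((P.roots.map fun x : ℝ => f x).sum + (n - P.natDegree : ℕ) * f ⊥) := by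
  have h1 : ∫ z, f z ∂((n - P.natDegree) •
      (diracProba (⊥ : EReal)).toFiniteMeasure : FiniteMeasure EReal).toMeasure =
      (n - P.natDegree : ℕ) * f ⊥ := by
    rw [← Nat.cast_smul_eq_nsmul NNReal, FiniteMeasure.toMeasure_smul,
      integral_smul_nnreal_measure, NNReal.smul_def, NNReal.coe_natCast, smul_eq_mul]
    exact congrArg _ (integral_dirac _ _)
  rw [empiricalZeros, FiniteMeasure.toMeasure_smul, integral_smul_nnreal_measure,
    FiniteMeasure.toMeasure_add, integral_add_measure (f.integrable _) (f.integrable _),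
    integral_multiset_sum_dirac, h1]
  rw [NNReal.smul_def, smul_eq_mul, NNReal.coe_inv, NNReal.coe_natCast]

lemma log_eval_div_eval {s : Multiset ℝ} (hs : ∀ r ∈ s, 0 ≤ r) {t : ℝ} (ht : 0 < t) :
    Real.log ((shiftProd s).eval t / (shiftProd s).eval 1) =
      (s.map fun r => Real.log ((t + r) / (1 + r))).sum := by
  induction s using Multiset.induction_on with
  | empty => simp [shiftProd]
  | cons r s ih =>
    have hs' : ∀ x ∈ s, 0 ≤ x := fun x hx => hs x (Multiset.mem_cons_of_mem hx)
    have hr := hs r (Multiset.mem_cons_self r s)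
    have h1 : (0 : ℝ) < 1 + r := by linarith
    have h2 : 0 < t + r := by linarith
    have h3 := (div_pos (eval_shiftProd_pos hs' ht) (eval_shiftProd_pos hs' one_pos)).ne'
    rw [Multiset.map_cons, Multiset.sum_cons, ← ih hs', ← Real.log_mul (div_pos h2 h1).ne' h3,
      shiftProd_cons]
    simp [mul_div_mul_comm]

lemma tendsto_tiltMean_div {P : ℕ → ℝ[X]} {μ : ProbabilityMeasure EReal}
    (hroots : ∀ n, 1 ≤ n → NonposRooted (P n))
    (hconv : Tendsto (fun n => empiricalZeros n (P n)) atTop (𝓝 μ.toFiniteMeasure))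
    {t : ℝ} (ht : 0 < t) :
    Tendsto (fun n : ℕ => tiltMean (negRoots (P n)) t / n) atTop
      (𝓝 (meanFun (μ : Measure EReal) weight t)) := by
  have hcont : Continuous fun z => t * tiltKernel t (weight z) := by
    refine continuous_const.mul (continuous_weight.div ?_ fun z => ?_)
    · exact continuous_const.add (continuous_const.mul continuous_weight)
    · exact (tilt_denom_pos ht (weight_mem z).1 (weight_mem z).2).ne'
  let f : BoundedContinuousFunction EReal ℝ :=
    BoundedContinuousFunction.mkOfCompact ⟨_, hcont⟩
  refine ((FiniteMeasure.tendsto_iff_forall_integral_tendsto.1 hconv) f).congr' ?_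
  filter_upwards [eventually_ge_atTop 1] with n hn
  rw [integral_empiricalZeros, div_eq_inv_mul, tiltMean, negRoots, Multiset.map_map]
  have hbot : f ⊥ = 0 := by simp [f, weight_bot, tiltKernel]
  rw [hbot, mul_zero, add_zero]
  refine congrArg _ (congrArg _ (Multiset.map_congr rfl fun x hx => ?_))
  refine (mul_tiltKernel_weight_coe ht ((hroots n hn).roots_nonpos hx)).trans ?_
  rw [Function.comp_apply, ← sub_eq_add_neg, div_eq_mul_inv]

lemma tendsto_log_eval {P : ℕ → ℝ[X]} {μ : ProbabilityMeasure EReal}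
    (hroots : ∀ n, 1 ≤ n → NonposRooted (P n))
    (hconv : Tendsto (fun n => empiricalZeros n (P n)) atTop (𝓝 μ.toFiniteMeasure))
    {t : ℝ} (ht : 0 < t) :
    Tendsto (fun n : ℕ => (n : ℝ)⁻¹ * Real.log ((shiftProd (negRoots (P n))).eval t /
      (shiftProd (negRoots (P n))).eval 1)) atTop (𝓝 (potFun (μ : Measure EReal) weight t)) := by
  have hcont : Continuous fun z => Real.log (1 + (t - 1) * weight z) :=
    (continuous_const.add (continuous_const.mul continuous_weight)).log fun z =>
      (tilt_denom_pos ht (weight_mem z).1 (weight_mem z).2).ne'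
  let f : BoundedContinuousFunction EReal ℝ :=
    BoundedContinuousFunction.mkOfCompact ⟨_, hcont⟩
  refine ((FiniteMeasure.tendsto_iff_forall_integral_tendsto.1 hconv) f).congr' ?_
  filter_upwards [eventually_ge_atTop 1] with n hn
  rw [integral_empiricalZeros, log_eval_div_eval (hroots n hn).negRoots_nonneg ht, negRoots,
    Multiset.map_map]
  have hbot : f ⊥ = 0 := by simp [f, weight_bot]
  rw [hbot, mul_zero, add_zero]
  refine congrArg _ (congrArg _ (Multiset.map_congr rfl fun x hx => ?_))
  refine (log_tilt_weight_coe ((hroots n hn).roots_nonpos hx)).trans ?_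
  rw [Function.comp_apply, ← sub_eq_add_neg, ← sub_eq_add_neg]

/-! ### The statements in extended numbers -/

lemma logCoeff_of_pos {P : ℝ[X]} (h : NonposRooted P) {n k : ℕ}
    (ha : 0 < (shiftProd (negRoots P)).coeff k) :
    logCoeff n P k = (((n : ℝ)⁻¹ * Real.log ((shiftProd (negRoots P)).coeff k /
      (shiftProd (negRoots P)).eval 1) : ℝ) : EReal) := by
  rw [logCoeff, h.coeff_div_eval, ENNReal.log_ofReal_of_pos
    (div_pos ha (eval_shiftProd_pos h.negRoots_nonneg one_pos)), EReal.coe_mul]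

lemma logCoeff_of_eq_zero {P : ℝ[X]} (h : NonposRooted P) {n k : ℕ} (hn : 0 < n)
    (ha : (shiftProd (negRoots P)).coeff k = 0) : logCoeff n P k = ⊥ := by
  rw [logCoeff, h.coeff_div_eval, ha, zero_div, ENNReal.ofReal_zero, ENNReal.log_zero,
    EReal.coe_mul_bot_of_pos (by positivity)]

lemma tendsto_iSup_zero_of_forall_le {q : ℕ → ℕ → Prop} {f : ℕ → ℕ → ENNReal}
    (h : ∀ η : ℝ, 0 < η → ∀ᶠ n in atTop, ∀ k, q n k → f n k ≤ ENNReal.ofReal η) :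
    Tendsto (fun n => ⨆ (k : ℕ) (_ : q n k), f n k) atTop (𝓝 0) := by
  refine ENNReal.tendsto_nhds_zero.2 fun ε hε => ?_
  obtain ⟨r, hr0, hr⟩ := ENNReal.lt_iff_exists_nnreal_btwn.1 hε
  filter_upwards [h r (by exact_mod_cast hr0)] with n hn
  refine iSup₂_le fun k hk => (hn k hk).trans ?_
  rw [ENNReal.ofReal_coe_nnreal]
  exact hr.le

lemma tendsto_iSup_bot_of_forall_le {q : ℕ → ℕ → Prop} {f : ℕ → ℕ → EReal}
    (h : ∀ B : ℝ, 0 < B → ∀ᶠ n in atTop, ∀ k, q n k → f n k ≤ ((-B : ℝ) : EReal)) :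
    Tendsto (fun n => ⨆ (k : ℕ) (_ : q n k), f n k) atTop (𝓝 ⊥) := by
  refine EReal.tendsto_nhds_bot_iff_real.2 fun x => ?_
  filter_upwards [h (|x| + 1) (by positivity)] with n hn
  refine (iSup₂_le hn).trans_lt ?_
  rw [EReal.coe_lt_coe_iff]
  linarith [neg_abs_le x]

lemma tendsto_iInf_top_of_forall_le {q : ℕ → ℕ → Prop} {f : ℕ → ℕ → EReal}
    (h : ∀ B : ℝ, 0 < B → ∀ᶠ n in atTop, ∀ k, q n k → ((B : ℝ) : EReal) ≤ f n k) :
    Tendsto (fun n => ⨅ (k : ℕ) (_ : q n k), f n k) atTop (𝓝 ⊤) := by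
  refine EReal.tendsto_nhds_top_iff_real.2 fun x => ?_
  filter_upwards [h (|x| + 1) (by positivity)] with n hn
  refine lt_of_lt_of_le ?_ (le_iInf₂ hn)
  rw [EReal.coe_lt_coe_iff]
  linarith [le_abs_self x]

lemma div_mem_Icc_of_le {a b : ℝ} {n k : ℕ} (hn : 0 < n) (h : a * n ≤ k ∧ (k : ℝ) ≤ b * n) :
    (k / n : ℝ) ∈ Icc a b := by
  have hn' : (0 : ℝ) < n := by exact_mod_cast hn
  exact ⟨(le_div_iff₀ hn').2 h.1, (div_le_iff₀ hn').2 h.2⟩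

end ZerosProfile

open ZerosProfile MeasureTheory Set Filter in
theorem mainTheorem2
    (P : ℕ → ℝ[X])
    (hdeg : ∀ n, 1 ≤ n → (P n).natDegree ≤ n)
    (hroots : ∀ n, 1 ≤ n → ZerosProfile.NonposRooted (P n))
    (μ : MeasureTheory.ProbabilityMeasure EReal)
    (hμ : μ (Set.Iic 0) = 1)
    (hconv : Filter.Tendsto (fun n => ZerosProfile.empiricalZeros n (P n)) Filter.atTop
      (𝓝 μ.toFiniteMeasure))
    (m₀ m₁ : ℝ) (hm₀ : m₀ = (μ {(0 : EReal)} : ℝ)) (hm₁ : m₁ = 1 - (μ {(⊥ : EReal)} : ℝ)) :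
    (0 ≤ m₀ ∧ m₀ ≤ m₁ ∧ m₁ ≤ 1) ∧
    ∃ g : ℝ → ℝ,
      -- (a)
      StrictConcaveOn ℝ (Set.Ioo m₀ m₁) g ∧
      ContDiffOn ℝ ∞ g (Set.Ioo m₀ m₁) ∧
      (∀ α ∈ Set.Ioo m₀ m₁, g α ≤ 0) ∧
      (∀ ε : ℝ, 0 < ε → Filter.Tendsto
        (fun n : ℕ => ⨆ (k : ℕ) (_ : (m₀ + ε) * n ≤ k ∧ (k : ℝ) ≤ (m₁ - ε) * n),
          (ZerosProfile.logCoeff n (P n) k - ((g ((k : ℝ) / n) : ℝ) : EReal)).abs)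
        Filter.atTop (𝓝 (0 : ENNReal))) ∧
      (∀ ε : ℝ, 0 < ε → Filter.Tendsto
        (fun n : ℕ => ⨆ (k : ℕ) (_ : (k : ℝ) ≤ (m₀ - ε) * n), ZerosProfile.logCoeff n (P n) k)
        Filter.atTop (𝓝 (⊥ : EReal))) ∧
      (∀ ε : ℝ, 0 < ε → Filter.Tendsto
        (fun n : ℕ => ⨆ (k : ℕ) (_ : (m₁ + ε) * n ≤ k ∧ k ≤ n), ZerosProfile.logCoeff n (P n) k)
        Filter.atTop (𝓝 (⊥ : EReal))) ∧
      -- (b)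
      (m₀ < m₁ →
        Set.MapsTo (fun t => t * ZerosProfile.cauchyTransform μ t) (Set.Ioi 0) (Set.Ioo m₀ m₁) ∧
        Set.InvOn (fun t => t * ZerosProfile.cauchyTransform μ t) (fun α => Real.exp (-deriv g α))
          (Set.Ioo m₀ m₁) (Set.Ioi 0)) ∧
      -- (c)
      (m₀ < m₁ →
        Filter.Tendsto (deriv g) (𝓝[>] m₀) Filter.atTop ∧
        Filter.Tendsto (deriv g) (𝓝[<] m₁) Filter.atBot) ∧
      -- (d)
      (∀ α ∈ Set.Ioo m₀ m₁,
        IsLUB (Set.range fun u : ℝ => α * u - ZerosProfile.logPotential μ (Real.exp u)) (-g α)) ∧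
      (m₀ < m₁ → IsLUB (g '' Set.Ioo m₀ m₁) 0) ∧
      -- (e), and (f) since no strict inequality between the endpoints is assumed
      (∀ ε : ℝ, 0 < ε → Filter.Tendsto
        (fun n : ℕ => ⨆ (k : ℕ) (_ : (m₀ + ε) * n ≤ k ∧ (k : ℝ) ≤ (m₁ - ε) * n),
          ENNReal.ofReal
            |(P n).coeff (k + 1) / (P n).coeff k - Real.exp (deriv g ((k : ℝ) / n))|)
        Filter.atTop (𝓝 (0 : ENNReal))) ∧
      (∀ ε : ℝ, 0 < ε → Filter.Tendsto
        (fun n : ℕ => ⨅ (k : ℕ)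
            (_ : ZerosProfile.lowestIndex (P n) ≤ k ∧ (k : ℝ) ≤ (m₀ - ε) * n),
          (((P n).coeff (k + 1) / (P n).coeff k : ℝ) : EReal))
        Filter.atTop (𝓝 (⊤ : EReal))) ∧
      (∀ ε : ℝ, 0 < ε → Filter.Tendsto
        (fun n : ℕ => ⨅ (k : ℕ) (_ : (m₁ + ε) * n ≤ k ∧ k < (P n).natDegree),
          (((P n).coeff k / (P n).coeff (k + 1) : ℝ) : EReal))
        Filter.atTop (𝓝 (⊤ : EReal))) := by
  set ν : Measure EReal := (μ : Measure EReal) with hν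
  have hae : ∀ᵐ z ∂ν, z ≤ 0 := by
    have h1 : ν (Iic 0) = 1 := by
      rw [hν, ← ProbabilityMeasure.ennreal_coeFn_eq_coeFn_toMeasure, hμ, ENNReal.coe_one]
    exact (prob_compl_eq_zero_iff measurableSet_Iic).2 h1
  have hw : Measurable weight := continuous_weight.measurable
  have h01 := weight_mem
  have e0 : ν.real {z | weight z = 1} = m₀ := by
    rw [measure_weight_eq_one hae, hm₀]
    rfl
  have e1 : 1 - ν.real {z | weight z = 0} = m₁ := by
    rw [setOf_weight_eq_zero, hm₁]
    rfl
  have hrange : meanRange ν weight = Ioo m₀ m₁ := by rw [meanRange, e0, e1]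
  have hM := fun t (ht : 0 < t) => tendsto_tiltMean_div hroots hconv ht
  have hL := fun t (ht : 0 < t) => tendsto_log_eval hroots hconv ht
  have hP : ∀ᶠ n in atTop, NonposRooted (P n) := by
    filter_upwards [eventually_ge_atTop 1] with n hn using hroots n hn
  have hs : ∀ᶠ n in atTop, ∀ r ∈ negRoots (P n), 0 ≤ r := by
    filter_upwards [hP] with n hn using hn.negRoots_nonneg
  have hcard : ∀ᶠ n in atTop, (negRoots (P n)).card ≤ n := by
    filter_upwards [eventually_ge_atTop 1] with n hn
    rw [(hroots n hn).card_negRoots]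
    exact hdeg n hn
  have hK : ∀ ε : ℝ, 0 < ε → Icc (m₀ + ε) (m₁ - ε) ⊆ meanRange ν weight := by
    intro ε hε x hx
    rw [hrange]
    exact ⟨by linarith [hx.1], by linarith [hx.2]⟩
  have hlt' : m₀ < m₁ → ν.real {z | weight z = 1} < 1 - ν.real {z | weight z = 0} := by
    rw [e0, e1]; exact id
  have hm01 := (le_meanFun (ν := ν) hw h01 one_pos).trans (meanFun_le hw h01 one_pos)
  rw [e0, e1] at hm01
  have hm1 : m₁ ≤ 1 := by
    rw [← e1]
    exact sub_le_self 1 measureReal_nonneg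
  refine ⟨⟨e0 ▸ measureReal_nonneg, hm01, hm1⟩, profile ν weight, ?_, ?_, ?_, ?_, ?_, ?_, ?_,
    ?_, ?_, ?_, ?_, ?_, ?_⟩
  · rw [← hrange]; exact strictConcaveOn_profile hw h01
  · rw [← hrange]; exact contDiffOn_profile hw h01
  · rw [← hrange]; exact fun α hα => profile_nonpos hw h01 hα
  · refine fun ε hε => tendsto_iSup_zero_of_forall_le fun η hη => ?_
    filter_upwards [eventually_log_coeff_near hw h01 hs hcard hM hL isCompact_Icc (hK ε hε) hη,
      hP, eventually_gt_atTop 0] with n hn hPn hn0 k hk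
    obtain ⟨ha, hle⟩ := hn k (div_mem_Icc_of_le hn0 hk)
    rw [logCoeff_of_pos hPn ha, ← EReal.coe_sub, EReal.abs_def]
    exact ENNReal.ofReal_le_ofReal hle
  · refine fun ε hε => tendsto_iSup_bot_of_forall_le fun B hB => ?_
    filter_upwards [eventually_log_coeff_le_of_le hw h01 hs hL hε hB,
      hP, eventually_gt_atTop 0] with n hn hPn hn0 k hk
    rw [e0] at hn
    rcases ((strongLogConcave_shiftProd hPn.negRoots_nonneg).1 k).eq_or_lt with ha | ha
    · rw [logCoeff_of_eq_zero hPn hn0 ha.symm]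
      exact bot_le
    · rw [logCoeff_of_pos hPn ha, EReal.coe_le_coe_iff]
      exact hn k hk ha
  · refine fun ε hε => tendsto_iSup_bot_of_forall_le fun B hB => ?_
    filter_upwards [eventually_log_coeff_le_of_ge hw h01 hs hL hε hB,
      hP, eventually_gt_atTop 0] with n hn hPn hn0 k hk
    rw [e1] at hn
    rcases ((strongLogConcave_shiftProd hPn.negRoots_nonneg).1 k).eq_or_lt with ha | ha
    · rw [logCoeff_of_eq_zero hPn hn0 ha.symm]
      exact bot_le
    · rw [logCoeff_of_pos hPn ha, EReal.coe_le_coe_iff]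
      exact hn k hk.1 ha
  · intro hlt
    have hlt := hlt' hlt
    rw [← hrange]
    refine ⟨fun t ht => ?_, fun α hα => ?_, fun t ht => ?_⟩
    · beta_reduce
      rw [mul_cauchyTransform_eq hae ht]
      exact meanFun_mem_meanRange hw h01 hlt ht
    · beta_reduce
      rw [exp_neg_deriv_profile hw h01 hα, mul_cauchyTransform_eq hae (tiltOf_pos hw h01 hα),
        meanFun_tiltOf hw h01 hα]
    · beta_reduce
      rw [mul_cauchyTransform_eq hae ht, exp_neg_deriv_profile hw h01
        (meanFun_mem_meanRange hw h01 hlt ht), tiltOf_meanFun hw h01 hlt ht]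
  · intro hlt
    have h1 := tendsto_deriv_profile_left (ν := ν) hw h01 (hlt' hlt)
    have h2 := tendsto_deriv_profile_right (ν := ν) hw h01 (hlt' hlt)
    rw [e0] at h1
    rw [e1] at h2
    exact ⟨h1, h2⟩
  · intro α hα
    rw [← hrange] at hα
    simp_rw [logPotential_eq hae]
    exact isLUB_neg_profile hw h01 hα
  · intro hlt
    rw [← hrange]
    exact isLUB_profile hw h01 (hlt' hlt)
  · refine fun ε hε => tendsto_iSup_zero_of_forall_le fun η hη => ?_
    filter_upwards [eventually_ratio_near hw h01 hs hM isCompact_Icc (hK ε hε) hη,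
      hP, eventually_gt_atTop 0] with n hn hPn hn0 k hk
    have hmem := div_mem_Icc_of_le hn0 hk
    rw [hPn.coeff_div_coeff, exp_deriv_profile hw h01 (hK ε hε hmem)]
    exact ENNReal.ofReal_le_ofReal (hn k hmem)
  · refine fun ε hε => tendsto_iInf_top_of_forall_le fun B hB => ?_
    filter_upwards [eventually_lt_tiltMean_of_le hw h01 hM hε (inv_pos.2 hB), hP]
      with n hn hPn k hk
    rw [e0] at hn
    have hsn := hPn.negRoots_nonneg
    have hlt := hn k hk.2
    have hle : k + 1 ≤ (P n).natDegree := by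
      rw [← hPn.card_negRoots]
      exact_mod_cast (hlt.trans_le (tiltMean_le_card hsn (inv_pos.2 hB))).le
    have ha := hPn.coeff_pos_of_lowestIndex_le hk.1 (by omega)
    have h1 := coeff_le_of_lt_tiltMean hsn (inv_pos.2 hB) hlt
    rw [hPn.coeff_div_coeff, EReal.coe_le_coe_iff, le_div_iff₀ ha]
    rwa [inv_mul_eq_div, le_div_iff₀ hB, mul_comm] at h1
  · refine fun ε hε => tendsto_iInf_top_of_forall_le fun B hB => ?_
    filter_upwards [eventually_tiltMean_lt_of_le hw h01 hM hε hB, hP] with n hn hPn k hk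
    rw [e1] at hn
    have hsn := hPn.negRoots_nonneg
    have hlt := hn k hk.1
    have hcount : (negRoots (P n)).count 0 < k := by
      exact_mod_cast (count_zero_le_tiltMean hsn hB).trans_lt hlt
    have ha := coeff_shiftProd_pos hsn (k := k + 1) (by omega) (by
      rw [hPn.card_negRoots]
      exact hk.2)
    rw [hPn.coeff_div_coeff, EReal.coe_le_coe_iff, le_div_iff₀ ha]
    exact mul_coeff_le_of_tiltMean_lt hsn hB hlt
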